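/- **Notation.** Let $\mathbb{D}$ be the open unit disc in $\mathbb{C}$, let $H^2$ be the Hardy space on $\mathbb{D}$, and let $H^\infty(\mathbb{D}^2)$ be the algebra of bounded holomorphic functions on $\mathbb{D}^2$. For a bounded holomorphic function $\Phi:\mathbb{D}\to B(\mathbb{C}^d)$, let $M_\Phi$ be the multiplication operator $(M_\Phi g)(z)=\Phi(z)g(z)$ on $H^2\otimes\mathbb{C}^d$, the Hardy space of $\mathbb{C}^d$-valued functions; $M_z\otimes I$ is the case $\Phi(z)=zI$. A *rational matrix-valued pure inner function* is a bounded holomorphic $\Psi:\mathbb{D}\to B(\mathbb{C}^d)$ whose matrix entries are rational functions, for which $M_\Psi$ is an isometry, and such that $\Psi(z)$ has no eigenvalue of modulus $1$ for any $z\in\mathbb{D}$. For such $\Psi$ put $$V_\Psi=\{(z,w)\in\mathbb{D}^2:\det(\Psi(z)-wI)=0\},$$ and for $f\in H^\infty(\mathbb{D}^2)$ let $f(M_z\otimes I,M_\Psi)=M_{f\circ\Delta_\Psi}$, where $(f\circ\Delta_\Psi)(z)=f(z,\Psi(z))$ is given by the holomorphic functional calculus of the matrix $\Psi(z)$ (whose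 spectrum lies in $\mathbb{D}$) applied to $w\mapsto f(z,w)$. Let $\operatorname{Ann}(M_z\otimes I,M_\Psi)=\{f\in H^\infty(\mathbb{D}^2): f(M_z\otimes I,M_\Psi)=0\}$. For an ideal $F\subset H^\infty(\mathbb{D}^2)$, let $Z(F)\subset\mathbb{D}^2$ be its set of common zeros in $\mathbb{D}^2$, and let $\operatorname{supp}(F)$ be the set of all $(\lambda,\mu)\in\mathbb{C}^2$ such that $1\notin F+(z-\lambda)H^\infty(\mathbb{D}^2)+(w-\mu)H^\infty(\mathbb{D}^2)$. The Taylor spectrum of a commuting pair of operators is denoted by $\sigma$. **Theorem.** Let $T_1,T_2$ be commuting contractions on a Hilbert space $H$ such that, for $i=1,2$, the operator $T_i$ is pure (that is, $\|T_i^{*n}h\|\to0$ for every $h\in H$) and has finite defect (that is, the range of $I-T_iT_i^*$ is finite-dimensional). Let $d=\dim\operatorname{ran}(I-T_1T_1^*)$, let $\Psi:\mathbb{D}\to B(\mathbb{C}^d)$ be a rational matrix-valued pure inner function, and let $J:H\to H^2\otimes\mathbb{C}^d$ be an isometry such that $$JT_1^*=(M_z\otimes I)^*J,\qquad JT_2^*=M_\Psi^*J.$$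 For $f\in H^\infty(\mathbb{D}^2)$ put $f(T_1,T_2)=J^*f(M_z\otimes I,M_\Psi)J$, let $\operatorname{Ann}(T_1,T_2)=\{f\in H^\infty(\mathbb{D}^2): f(T_1,T_2)=0\}$, let $$K_\Psi=\bigcap_{f\in\operatorname{Ann}(T_1,T_2)}\ker f(M_z\otimes I,M_\Psi)^*,$$ and let $S_1^\Psi=P_{K_\Psi}(M_z\otimes I)|_{K_\Psi}$ and $S_2^\Psi=P_{K_\Psi}M_\Psi|_{K_\Psi}$ be the constrained isometric co-extension of $(T_1,T_2)$ corresponding to $\Psi$. Then $$\sigma(S_1^\Psi,S_2^\Psi)\subset\operatorname{supp}(\operatorname{Ann}(T_1,T_2))\subset\overline{V_\Psi}=\operatorname{supp}(\operatorname{Ann}(M_z\otimes I,M_\Psi))$$ and $$\sigma(S_1^\Psi,S_2^\Psi)\cap\mathbb{D}^2=\operatorname{supp}(\operatorname{Ann}(T_1,T_2))\cap\mathbb{D}^2=Z(\operatorname{Ann}(T_1,T_2)).$$ -/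

import Mathlib

open Filter Topology

noncomputable section

namespace Bidisc

/-! ### The Hardy space of vector-valued functions and its multiplication operators -/

/-- The Hardy space `H²(E) = H² ⊗ E` on the unit disc: the power series `∑ zⁿ fₙ` with
square-summable coefficients `fₙ ∈ E`, represented by the sequence `(fₙ)`. -/
abbrev Hardy (E : Type*) [NormedAddCommGroup E] [InnerProductSpace ℂ E] : Type _ :=
  lp (fun _ : ℕ => E) 2

/-- The open unit disc. -/
def disc : Set ℂ := Metric.ball 0 1

/-- The open unit bidisc. -/
def bidisc : Set (ℂ × ℂ) := disc ×ˢ disc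

section Hardy

variable {E : Type*} [NormedAddCommGroup E] [InnerProductSpace ℂ E]

/-- The value at `z` (in the unit disc) of an element of the Hardy space. -/
def Hardy.eval (f : Hardy E) (z : ℂ) : E := ∑' n : ℕ, z ^ n • f n

/-- `M` is the operator of multiplication by `Φ`: `(M f)(z) = Φ(z) f(z)` for `z` in the disc. -/
def IsMultOp (Φ : ℂ → E →L[ℂ] E) (M : Hardy E →L[ℂ] Hardy E) : Prop :=
  ∀ f : Hardy E, ∀ z ∈ disc, Hardy.eval (M f) z = Φ z (Hardy.eval f z)

open Classical in
/-- The bounded multiplication operator `M_Φ` on `H²(E)`, for a multiplier `Φ` (in particular,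
for every bounded holomorphic `Φ`). It is unique, see `multOp_eq`. -/
def multOp (Φ : ℂ → E →L[ℂ] E) : Hardy E →L[ℂ] Hardy E :=
  if h : ∃ M : Hardy E →L[ℂ] Hardy E, IsMultOp Φ M then h.choose else 0

/-- An element of the Hardy space is determined by its values in the disc. -/
theorem Hardy.eval_injective [CompleteSpace E] {f g : Hardy E}
    (h : ∀ z ∈ disc, Hardy.eval f z = Hardy.eval g z) : f = g := by
  have key : ∀ f : Hardy E, HasFPowerSeriesAt (Hardy.eval f)
      (fun n => ContinuousMultilinearMap.mkPiRing ℂ (Fin n) (f n)) 0 := by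
    intro f
    have hr : (1 : ENNReal) ≤ FormalMultilinearSeries.radius
        (fun n => ContinuousMultilinearMap.mkPiRing ℂ (Fin n) (f n) :
          FormalMultilinearSeries ℂ ℂ E) := by
      have := FormalMultilinearSeries.le_radius_of_bound
        (p := (fun n => ContinuousMultilinearMap.mkPiRing ℂ (Fin n) (f n) :
          FormalMultilinearSeries ℂ ℂ E)) (r := 1) ‖f‖ (fun n => by
            simpa using lp.norm_apply_le_norm (by norm_num) f n)
      simpa using this
    refine ⟨1, hr, by norm_num, fun {y} hy => ?_⟩
    have h1 := FormalMultilinearSeries.hasSum _ (Metric.eball_subset_eball hr hy)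
    have h2 := h1.tsum_eq
    rw [← h2] at h1
    convert h1 using 1
    simp only [Hardy.eval, zero_add]
    congr 1
    ext n
    simp
  have hE : Hardy.eval f =ᶠ[𝓝 0] Hardy.eval g := by
    filter_upwards [Metric.ball_mem_nhds (0 : ℂ) one_pos] with z hz using h z hz
  have := HasFPowerSeriesAt.eq_formalMultilinearSeries ((key f).congr hE) (key g)
  ext n
  have h3 := congrFun this n
  have h4 := congrArg (fun m => m (fun _ => (1 : ℂ))) h3
  simpa using h4

/-- The multiplication operator with a given symbol is unique. -/
theorem multOp_eq [CompleteSpace E] {Φ : ℂ → E →L[ℂ] E} {M : Hardy E →L[ℂ] Hardy E}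
    (hM : IsMultOp Φ M) : multOp Φ = M := by
  have h : ∃ M : Hardy E →L[ℂ] Hardy E, IsMultOp Φ M := ⟨M, hM⟩
  rw [multOp, dif_pos h]
  ext1 f
  exact Hardy.eval_injective fun z hz => by rw [h.choose_spec f z hz, hM f z hz]

/-- The shift `M_z ⊗ I` on `H²(E)`. -/
def shift : Hardy E →L[ℂ] Hardy E := multOp fun z => z • ContinuousLinearMap.id ℂ E

end Hardy

/-! ### Operators -/

section Operators

variable {H : Type*} [NormedAddCommGroup H] [InnerProductSpace ℂ H] [CompleteSpace H]

/-- A contraction `T` is pure (of class `C_{·0}`) if `‖T*ⁿ h‖ → 0` for every `h`. -/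
def IsPureContraction (T : H →L[ℂ] H) : Prop :=
  ‖T‖ ≤ 1 ∧ ∀ h : H, Tendsto (fun n : ℕ => ‖((ContinuousLinearMap.adjoint T) ^ n) h‖) atTop (𝓝 0)

/-- The range of `I - T T*`. -/
def defectSpace (T : H →L[ℂ] H) : Submodule ℂ H :=
  (ContinuousLinearMap.id ℂ H - T ∘L ContinuousLinearMap.adjoint T : H →L[ℂ] H).range

/-- The compression `P_K A |_K` of an operator `A` to a closed subspace `K`. -/
def compression (K : Submodule ℂ H) [K.HasOrthogonalProjection] (A : H →L[ℂ] H) : K →L[ℂ] K :=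
  K.orthogonalProjectionOnto ∘L A ∘L K.subtypeL

end Operators

section Taylor

variable {X : Type*} [NormedAddCommGroup X] [NormedSpace ℂ X]

/-- The first map `x ↦ (A x, B x)` of the Koszul complex `0 → X → X × X → X → 0` of `(A, B)`. -/
def koszul₀ (A B : X →L[ℂ] X) : X → X × X := fun x => (A x, B x)

/-- The second map `(x, y) ↦ A y - B x` of the Koszul complex of `(A, B)`. -/
def koszul₁ (A B : X →L[ℂ] X) : X × X → X := fun p => A p.2 - B p.1

/-- The Taylor spectrum of a commuting pair `(A, B)`: the points `(λ, μ)` for which the Koszul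
complex of `(A - λ, B - μ)` is not exact. -/
def taylorSpectrum (A B : X →L[ℂ] X) : Set (ℂ × ℂ) :=
  {p | ¬ (Function.Injective (koszul₀ (A - p.1 • .id ℂ X) (B - p.2 • .id ℂ X)) ∧
    Function.Exact (koszul₀ (A - p.1 • .id ℂ X) (B - p.2 • .id ℂ X))
      (koszul₁ (A - p.1 • .id ℂ X) (B - p.2 • .id ℂ X)) ∧
    Function.Surjective (koszul₁ (A - p.1 • .id ℂ X) (B - p.2 • .id ℂ X)))}

end Taylor

/-! ### Bounded holomorphic functions on the bidisc -/

/-- `H^∞(𝔻²)`: the bounded holomorphic functions on the bidisc, represented by functions on `ℂ²`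
whose values off the bidisc are irrelevant. -/
def HInf : Set (ℂ × ℂ → ℂ) :=
  {f | DifferentiableOn ℂ f bidisc ∧ ∃ C : ℝ, ∀ p ∈ bidisc, ‖f p‖ ≤ C}

/-- The support of an ideal `F` of `H^∞(𝔻²)`: the points `(λ, μ)` of `ℂ²` such that `1` does not
belong to `F + (z - λ) H^∞(𝔻²) + (w - μ) H^∞(𝔻²)`. -/
def supp (F : Set (ℂ × ℂ → ℂ)) : Set (ℂ × ℂ) :=
  {a | ¬ ∃ φ ∈ F, ∃ f ∈ HInf, ∃ g ∈ HInf, ∀ p ∈ bidisc,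
    1 = φ p + (p.1 - a.1) * f p + (p.2 - a.2) * g p}

/-- The common zero set in the bidisc of a set of functions. -/
def zeroSet (F : Set (ℂ × ℂ → ℂ)) : Set (ℂ × ℂ) := {p ∈ bidisc | ∀ f ∈ F, f p = 0}

/-! ### Rational pure inner functions, and the constrained isometric co-extension -/

/-- `ℂ^d` with its Euclidean norm. -/
abbrev Cd (d : ℕ) : Type := EuclideanSpace ℂ (Fin d)

variable {d : ℕ}

/-- `Ψ ∈ H^∞(𝔻; B(ℂ^d))` is a rational matrix-valued pure inner function: it is bounded and
holomorphic in the disc, its entries are rational functions, `M_Ψ` is an isometry, and no `Ψ(z)`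
with `z` in the open disc has a unimodular eigenvalue. -/
structure IsRationalPureInner (Ψ : ℂ → Cd d →L[ℂ] Cd d) : Prop where
  holomorphic : DifferentiableOn ℂ Ψ disc
  bounded : ∃ C : ℝ, ∀ z ∈ disc, ‖Ψ z‖ ≤ C
  rational : ∀ i j : Fin d, ∃ p q : Polynomial ℂ, ∀ z ∈ disc, q.eval z ≠ 0 ∧
    (Ψ z (EuclideanSpace.single j 1)) i = p.eval z / q.eval z
  inner : ∀ f : Hardy (Cd d), ‖multOp Ψ f‖ = ‖f‖
  pure : ∀ z ∈ disc, ∀ w : ℂ,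
    Module.End.HasEigenvalue (Ψ z : Cd d →ₗ[ℂ] Cd d) w → ‖w‖ ≠ 1

/-- The variety `V_Ψ = {(z, w) ∈ 𝔻² : det (Ψ(z) - w I) = 0}`. -/
def variety (Ψ : ℂ → Cd d →L[ℂ] Cd d) : Set (ℂ × ℂ) :=
  {p ∈ bidisc | (Ψ p.1 - p.2 • ContinuousLinearMap.id ℂ (Cd d)).det = 0}

/-- The function `(f ∘ Δ_Ψ)(z) = f(z, Ψ(z))`: the holomorphic function `w ↦ f(z, w) = ∑ aₙ wⁿ` on
the unit disc is evaluated at the matrix `Ψ(z)`, whose spectrum lies in the unit disc, so that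
`f(z, Ψ(z)) = ∑ aₙ Ψ(z)ⁿ` converges absolutely. -/
def compΔ (f : ℂ × ℂ → ℂ) (Ψ : ℂ → Cd d →L[ℂ] Cd d) : ℂ → Cd d →L[ℂ] Cd d := fun z =>
  ∑' n : ℕ, ((n.factorial : ℂ)⁻¹ * iteratedDeriv n (fun w => f (z, w)) 0) • Ψ z ^ n

/-- The operator `f(M_z ⊗ I, M_Ψ) = M_{f ∘ Δ_Ψ}`. -/
def modelCalc (Ψ : ℂ → Cd d →L[ℂ] Cd d) (f : ℂ × ℂ → ℂ) :
    Hardy (Cd d) →L[ℂ] Hardy (Cd d) :=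
  multOp (compΔ f Ψ)

/-- The annihilator of `(M_z ⊗ I, M_Ψ)` in `H^∞(𝔻²)`. -/
def modelAnn (Ψ : ℂ → Cd d →L[ℂ] Cd d) : Set (ℂ × ℂ → ℂ) :=
  {f ∈ HInf | modelCalc Ψ f = 0}

section Coextension

variable {H : Type*} [NormedAddCommGroup H] [InnerProductSpace ℂ H] [CompleteSpace H]

/-- `J` and `Ψ` give an isometric co-extension `(M_z ⊗ I, M_Ψ)` of `(T₁, T₂)`:
`J T₁* = (M_z ⊗ I)* J` and `J T₂* = M_Ψ* J`. -/
def IsCoextension (T₁ T₂ : H →L[ℂ] H) (J : H →ₗᵢ[ℂ] Hardy (Cd d))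
    (Ψ : ℂ → Cd d →L[ℂ] Cd d) : Prop :=
  (∀ h, J (ContinuousLinearMap.adjoint T₁ h) = ContinuousLinearMap.adjoint shift (J h)) ∧
  (∀ h, J (ContinuousLinearMap.adjoint T₂ h) = ContinuousLinearMap.adjoint (multOp Ψ) (J h))

/-- The `H^∞(𝔻²)`-functional calculus `f(T₁, T₂) = J* f(M_z ⊗ I, M_Ψ) J` of a pair `(T₁, T₂)` with
isometric co-extension given by `J` and `Ψ`. -/
def pairCalc (J : H →ₗᵢ[ℂ] Hardy (Cd d)) (Ψ : ℂ → Cd d →L[ℂ] Cd d) (f : ℂ × ℂ → ℂ) : H →L[ℂ] H :=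
  ContinuousLinearMap.adjoint J.toContinuousLinearMap ∘L modelCalc Ψ f ∘L J.toContinuousLinearMap

/-- The annihilator `Ann(T₁, T₂) = {f ∈ H^∞(𝔻²) : f(T₁, T₂) = 0}`. -/
def ann (J : H →ₗᵢ[ℂ] Hardy (Cd d)) (Ψ : ℂ → Cd d →L[ℂ] Cd d) : Set (ℂ × ℂ → ℂ) :=
  {f ∈ HInf | pairCalc J Ψ f = 0}

/-- The space `K_Ψ`, the intersection of the kernels of `f(M_z ⊗ I, M_Ψ)*` over all
`f ∈ Ann(T₁, T₂)`. -/
def coextSpace (J : H →ₗᵢ[ℂ] Hardy (Cd d)) (Ψ : ℂ → Cd d →L[ℂ] Cd d) :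
    Submodule ℂ (Hardy (Cd d)) :=
  ⨅ f ∈ ann J Ψ, (ContinuousLinearMap.adjoint (modelCalc Ψ f)).ker

theorem isClosed_coextSpace (J : H →ₗᵢ[ℂ] Hardy (Cd d)) (Ψ : ℂ → Cd d →L[ℂ] Cd d) :
    IsClosed (coextSpace J Ψ : Set (Hardy (Cd d))) := by
  simp only [coextSpace, Submodule.coe_iInf]
  exact isClosed_iInter fun f => isClosed_iInter fun _ =>
    ContinuousLinearMap.isClosed_ker _

instance (J : H →ₗᵢ[ℂ] Hardy (Cd d)) (Ψ : ℂ → Cd d →L[ℂ] Cd d) :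
    CompleteSpace (coextSpace J Ψ) :=
  (isClosed_coextSpace J Ψ).completeSpace_coe

/-- `S₁ = P_K (M_z ⊗ I)|_K` with `K = K_Ψ`. -/
def coextS₁ (J : H →ₗᵢ[ℂ] Hardy (Cd d)) (Ψ : ℂ → Cd d →L[ℂ] Cd d) :
    coextSpace J Ψ →L[ℂ] coextSpace J Ψ :=
  compression (coextSpace J Ψ) shift

/-- `S₂ = P_K M_Ψ|_K` with `K = K_Ψ`. -/
def coextS₂ (J : H →ₗᵢ[ℂ] Hardy (Cd d)) (Ψ : ℂ → Cd d →L[ℂ] Cd d) :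
    coextSpace J Ψ →L[ℂ] coextSpace J Ψ :=
  compression (coextSpace J Ψ) (multOp Ψ)

end Coextension

end Bidisc

end

/-! The proof compares ideals and operators through the calculus `f ↦ f(z, Ψ(z))`. Each `Ψ(z)` is a
contraction, because `M_Ψ` is an isometry, and its eigenvalues lie in the open disc by purity. Hence
the series `∑ aₙ(z) Ψ(z)ⁿ` converges, and von Neumann's inequality (`norm_tsum_smul_pow_le`) bounds
it by the sup norm of `f`. So `f(z, Ψ(z))` is a multiplier, and `modelCalc` is an algebra
homomorphism. The space `K_Ψ` is invariant under the adjoints, so compression to it (`coextCalc`) is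
again multiplicative; it annihilates `Ann(T₁, T₂)`.

Spectrum inside support: an identity `1 = φ + (z - λ) f + (w - μ) g` with `φ ∈ Ann(T₁, T₂)` turns
into `(S₁ - λ) F + (S₂ - μ) G = 1` for commuting operators, which contracts the Koszul complex
(`notMem_taylorSpectrum`).

Support of the model annihilator: at `(z, w) ∈ V_Ψ` a left eigenvector of `Ψ(z)` shows that
annihilating functions vanish, so no such identity can hold near a point of the closure of `V_Ψ`.
Conversely, `χ(z, w) = det(w I - Ψ(z))` annihilates the model by Cayley–Hamilton. Its coefficients
are rational without poles on the closed disc, so `χ = c + (z - λ) f + (w - μ) g` even at boundary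
points (`charFun_mem_gleason`). Away from the closure of `V_Ψ`, the factorisation of `χ` over the
eigenvalues keeps it bounded below, so `c ≠ 0` and one may divide by it. Since `Ann(M_z ⊗ I, M_Ψ) ⊆
Ann(T₁, T₂)`, the support of the latter is the smaller one.

Inside the bidisc: Gleason division (`HInf.exists_sub_eq`) shows that points of the support are
common zeros. At a common zero, which lies in `V_Ψ` because `χ` vanishes there, the kernel vector
`k_z ⊗ v` with `v` a left eigenvector lies in `K_Ψ` and is orthogonal to the range of the last
Koszul map (`zeroSet_subset_taylorSpectrum`). The three inclusions close a cycle. -/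

open Filter Topology

noncomputable section

namespace Bidisc

open MeasureTheory Complex ContinuousLinearMap
open scoped InnerProductSpace Real ComplexOrder

/-! ### Parseval's identity and multipliers of the vector-valued Hardy space -/

section HardySpace

variable {E : Type*} [NormedAddCommGroup E] [InnerProductSpace ℂ E]

theorem integral_circleMap_pow (m n : ℕ) :
    ∫ θ in (0:ℝ)..2 * π, (starRingEnd ℂ) (circleMap 0 1 θ ^ n) * circleMap 0 1 θ ^ m =
      if m = n then ((2 * π : ℝ) : ℂ) else 0 := by
  have h1 : ∀ θ : ℝ, (starRingEnd ℂ) (circleMap 0 1 θ ^ n) * circleMap 0 1 θ ^ m =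
      exp (((m - n : ℂ) * I) * θ) := by
    intro θ
    simp only [circleMap, zero_add, ofReal_one, one_mul, ← exp_conj, map_mul, conj_I,
      conj_ofReal, map_natCast, ← exp_nat_mul, ← exp_add]
    congr 1; ring
  simp only [h1]
  split_ifs with h
  · subst h; simp
  · have hc : ((m : ℂ) - n) * I ≠ 0 :=
      mul_ne_zero (sub_ne_zero.2 (by exact_mod_cast h)) I_ne_zero
    rw [integral_exp_mul_complex hc]
    have : exp (((m : ℂ) - n) * I * ((2 * π : ℝ) : ℂ)) = 1 := by
      rw [exp_eq_one_iff]
      exact ⟨m - n, by push_cast; ring⟩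
    rw [this]; simp

theorem continuous_tsum_circleMap [CompleteSpace E] {b : ℕ → E} (hb : Summable fun n => ‖b n‖) :
    Continuous fun θ : ℝ => ∑' n, circleMap 0 1 θ ^ n • b n :=
  continuous_tsum (fun n => ((continuous_circleMap 0 1).pow n).smul continuous_const) hb
    fun n θ => by simp [norm_smul]

theorem integral_conj_circleMap_smul_tsum [CompleteSpace E] {b : ℕ → E}
    (hb : Summable fun n => ‖b n‖) (n : ℕ) :
    ∫ θ in (0:ℝ)..2 * π, (starRingEnd ℂ) (circleMap 0 1 θ ^ n) •
      ∑' m, circleMap 0 1 θ ^ m • b m = ((2 * π : ℝ) : ℂ) • b n := by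
  have hsum := intervalIntegral.hasSum_integral_of_dominated_convergence
    (μ := volume) (a := 0) (b := 2 * π)
    (F := fun m (θ : ℝ) => ((starRingEnd ℂ) (circleMap 0 1 θ ^ n) * circleMap 0 1 θ ^ m) • b m)
    (f := fun θ => (starRingEnd ℂ) (circleMap 0 1 θ ^ n) • ∑' m, circleMap 0 1 θ ^ m • b m)
    (fun m _ => ‖b m‖)
    (fun m => by
      refine Continuous.aestronglyMeasurable ?_
      have := continuous_circleMap 0 1
      fun_prop)
    (fun m => ae_of_all _ fun θ _ => by simp [norm_smul])
    (ae_of_all _ fun θ _ => hb)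
    (by simp)
    (ae_of_all _ fun θ _ => by
      have : Summable fun m => circleMap 0 1 θ ^ m • b m :=
        Summable.of_norm (by simpa [norm_smul] using hb)
      simpa [mul_smul] using this.hasSum.const_smul ((starRingEnd ℂ) (circleMap 0 1 θ ^ n)))
  rw [← hsum.tsum_eq, tsum_eq_single n]
  · rw [intervalIntegral.integral_smul_const, integral_circleMap_pow, if_pos rfl]
  · intro m hm
    rw [intervalIntegral.integral_smul_const, integral_circleMap_pow, if_neg hm, zero_smul]

/-- **Parseval's identity** for absolutely summable vector-valued power series on the circle. -/
theorem hasSum_sq_norm_of_summable [CompleteSpace E] {b : ℕ → E}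
    (hb : Summable fun n => ‖b n‖) :
    HasSum (fun n => 2 * π * ‖b n‖ ^ 2)
      (∫ θ in (0:ℝ)..2 * π, ‖∑' m, circleMap 0 1 θ ^ m • b m‖ ^ 2) := by
  set S : ℝ → E := fun θ => ∑' m, circleMap 0 1 θ ^ m • b m with hS
  have hSc : Continuous S := continuous_tsum_circleMap hb
  have hs : ∀ θ : ℝ, Summable fun m => circleMap 0 1 θ ^ m • b m := fun θ =>
    Summable.of_norm (by simpa [norm_smul] using hb)
  have hSb : ∀ θ, ‖S θ‖ ≤ ∑' n, ‖b n‖ := fun θ => by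
    refine (norm_tsum_le_tsum_norm (by simpa [norm_smul] using hb)).trans (le_of_eq ?_)
    simp [norm_smul]
  have hterm : ∀ n (θ : ℝ), ⟪circleMap 0 1 θ ^ n • b n, S θ⟫_ℂ =
      ⟪b n, (starRingEnd ℂ) (circleMap 0 1 θ ^ n) • S θ⟫_ℂ := fun n θ => by
    rw [inner_smul_left, inner_smul_right]
  have hsum := intervalIntegral.hasSum_integral_of_dominated_convergence
    (μ := volume) (a := 0) (b := 2 * π)
    (F := fun n (θ : ℝ) => ⟪circleMap 0 1 θ ^ n • b n, S θ⟫_ℂ)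
    (f := fun θ => ⟪S θ, S θ⟫_ℂ)
    (fun m _ => ‖b m‖ * ∑' n, ‖b n‖)
    (fun m => by
      refine Continuous.aestronglyMeasurable ?_
      have := continuous_circleMap 0 1
      fun_prop)
    (fun m => ae_of_all _ fun θ _ => by
      refine (norm_inner_le_norm _ _).trans ?_
      simpa [norm_smul] using mul_le_mul_of_nonneg_left (hSb θ) (norm_nonneg (b m)))
    (ae_of_all _ fun θ _ => hb.mul_right _)
    (by simp)
    (ae_of_all _ fun θ _ => by
      have h1 := ((innerSL ℂ (S θ)).hasSum (hs θ).hasSum)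
      have h2 := h1.star
      simp only [innerSL_apply_apply, RCLike.star_def, inner_conj_symm] at h2
      exact h2)
  have hi : ∀ n, ∫ θ in (0:ℝ)..2 * π, ⟪circleMap 0 1 θ ^ n • b n, S θ⟫_ℂ =
      ((2 * π * ‖b n‖ ^ 2 : ℝ) : ℂ) := fun n => by
    simp only [hterm]
    have := (innerSL ℂ (b n)).intervalIntegral_comp_comm (μ := volume) (a := 0) (b := 2 * π)
      (f := fun θ : ℝ => (starRingEnd ℂ) (circleMap 0 1 θ ^ n) • S θ) (by
        refine Continuous.intervalIntegrable ?_ _ _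
        have := continuous_circleMap 0 1
        fun_prop)
    simp only [innerSL_apply_apply] at this
    rw [this, integral_conj_circleMap_smul_tsum hb, inner_smul_right, inner_self_eq_norm_sq_to_K]
    push_cast; rfl
  simp only [hi] at hsum
  have hf : ∫ θ in (0:ℝ)..2 * π, ⟪S θ, S θ⟫_ℂ =
      ((∫ θ in (0:ℝ)..2 * π, ‖S θ‖ ^ 2 : ℝ) : ℂ) := by
    rw [← intervalIntegral.integral_ofReal]
    congr 1; ext θ
    rw [inner_self_eq_norm_sq_to_K]; push_cast; rfl
  rw [hf] at hsum
  exact_mod_cast hsum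

theorem Hardy.hasSum_sq_norm (f : Hardy E) : HasSum (fun n => ‖f n‖ ^ 2) (‖f‖ ^ 2) := by
  have := lp.hasSum_norm (p := 2) (by norm_num) f
  simpa using this

theorem Hardy.summable_eval [CompleteSpace E] (f : Hardy E) {z : ℂ} (hz : z ∈ disc) :
    Summable fun n => ‖z ^ n • f n‖ := by
  have hz' : ‖z‖ < 1 := by simpa [disc] using hz
  refine Summable.of_nonneg_of_le (fun _ => norm_nonneg _) (fun n => ?_)
    ((summable_geometric_of_lt_one (norm_nonneg z) hz').mul_right ‖f‖)
  rw [norm_smul, norm_pow]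
  gcongr
  exact lp.norm_apply_le_norm (by norm_num) f n

/-- Evaluation at a point of the disc, as a continuous linear map. -/
def Hardy.evalL [CompleteSpace E] (z : ℂ) (hz : z ∈ disc) : Hardy E →L[ℂ] E :=
  LinearMap.mkContinuous
    { toFun := fun f => Hardy.eval f z
      map_add' := fun f g => by
        simp only [Hardy.eval, lp.coeFn_add, Pi.add_apply, smul_add]
        exact (Hardy.summable_eval f hz).of_norm.tsum_add (Hardy.summable_eval g hz).of_norm
      map_smul' := fun c f => by
        simp only [Hardy.eval, lp.coeFn_smul, Pi.smul_apply, RingHom.id_apply]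
        rw [← (Hardy.summable_eval f hz).of_norm.tsum_const_smul c]
        simp only [smul_comm c] }
    (∑' n, ‖z‖ ^ n) fun f => by
      have hz' : ‖z‖ < 1 := by simpa [disc] using hz
      refine (norm_tsum_le_tsum_norm (Hardy.summable_eval f hz)).trans ?_
      rw [← tsum_mul_right]
      refine (Hardy.summable_eval f hz).tsum_le_tsum (fun n => ?_)
        ((summable_geometric_of_lt_one (norm_nonneg z) hz').mul_right ‖f‖)
      rw [norm_smul, norm_pow]
      gcongr
      exact lp.norm_apply_le_norm (by norm_num) f n

@[simp] theorem Hardy.evalL_apply [CompleteSpace E] {z : ℂ} (hz : z ∈ disc) (f : Hardy E) :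
    Hardy.evalL z hz f = Hardy.eval f z := rfl

/-- A power series dominated in the disc by an element of the Hardy space belongs to it. -/
theorem Hardy.exists_of_norm_le [CompleteSpace E] (f : Hardy E) {C : ℝ} (hC : 0 ≤ C) {c : ℕ → E}
    {g : ℂ → E} (hg : ∀ z ∈ disc, HasSum (fun n => z ^ n • c n) (g z))
    (hle : ∀ z ∈ disc, ‖g z‖ ≤ C * ‖Hardy.eval f z‖) :
    ∃ h : Hardy E, (∀ n, h n = c n) ∧ ‖h‖ ≤ C * ‖f‖ := by
  have hdisc : ∀ r : ℝ, 0 ≤ r → r < 1 → ∀ θ : ℝ, (r : ℂ) * circleMap 0 1 θ ∈ disc := by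
    intro r h0 h1 θ
    simpa [disc, abs_of_nonneg h0] using h1
  have hsumc : ∀ r : ℝ, 0 ≤ r → r < 1 → Summable fun n => ‖((r : ℂ) ^ n) • c n‖ := by
    intro r h0 h1
    -- Convergence at a larger radius `s` bounds the terms there; at radius `r` they are then
    -- dominated by the powers of `r / s`.
    obtain ⟨s, hrs, hs1⟩ := exists_between h1
    have hs0 : 0 < s := h0.trans_lt hrs
    have := (hg s (by simpa [disc, abs_of_nonneg hs0.le] using hs1)).summable.tendsto_atTop_zero
    obtain ⟨B, hB⟩ := (this.norm.bddAbove_range)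
    refine Summable.of_nonneg_of_le (fun _ => norm_nonneg _) (fun n => ?_)
      ((summable_geometric_of_lt_one (div_nonneg h0 hs0.le) ((div_lt_one hs0).2 hrs)).mul_right B)
    have hBn : ‖(s : ℂ) ^ n • c n‖ ≤ B := hB ⟨n, rfl⟩
    rw [norm_smul, norm_pow, norm_real, Real.norm_of_nonneg] at hBn ⊢ <;> try assumption
    · rw [div_pow]
      calc r ^ n * ‖c n‖ = r ^ n / s ^ n * (s ^ n * ‖c n‖) := by field_simp
        _ ≤ _ := by gcongr
    · exact hs0.le
  have hsumf : ∀ r : ℝ, 0 ≤ r → r < 1 → Summable fun n => ‖((r : ℂ) ^ n) • f n‖ := by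
    intro r h0 h1
    exact Hardy.summable_eval f (by simpa [disc, abs_of_nonneg h0] using h1)
  -- The pointwise bound is integrated over the circle of radius `r`, and Parseval is applied to
  -- both sides. Keeping to finite sums of coefficients lets `r` tend to `1` afterwards.
  have key : ∀ r : ℝ, 0 ≤ r → r < 1 → ∀ s : Finset ℕ,
      ∑ n ∈ s, (r ^ n * ‖c n‖) ^ 2 ≤ (C * ‖f‖) ^ 2 := by
    intro r h0 h1 s
    have hA := hasSum_sq_norm_of_summable (hsumc r h0 h1)
    have hB := hasSum_sq_norm_of_summable (hsumf r h0 h1)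
    have hle' : (∫ θ in (0:ℝ)..2 * π, ‖∑' m, circleMap 0 1 θ ^ m • (r : ℂ) ^ m • c m‖ ^ 2) ≤
        C ^ 2 * ∫ θ in (0:ℝ)..2 * π, ‖∑' m, circleMap 0 1 θ ^ m • (r : ℂ) ^ m • f m‖ ^ 2 := by
      rw [← intervalIntegral.integral_const_mul]
      refine intervalIntegral.integral_mono_on (by positivity) ?_ ?_ fun θ _ => ?_
      · exact ((continuous_tsum_circleMap (hsumc r h0 h1)).norm.pow 2).intervalIntegrable _ _
      · exact (((continuous_tsum_circleMap (hsumf r h0 h1)).norm.pow 2).const_smul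
          (C ^ 2)).intervalIntegrable _ _
      · have h2 := hle _ (hdisc r h0 h1 θ)
        rw [← (hg _ (hdisc r h0 h1 θ)).tsum_eq, Hardy.eval] at h2
        simp only [mul_pow, mul_smul, smul_comm ((r : ℂ) ^ _)] at h2
        rw [← mul_pow]
        gcongr
    have h2 : (∫ θ in (0:ℝ)..2 * π, ‖∑' m, circleMap 0 1 θ ^ m • (r : ℂ) ^ m • f m‖ ^ 2) ≤
        2 * π * ‖f‖ ^ 2 := by
      refine hasSum_le (fun n => ?_) hB ((Hardy.hasSum_sq_norm f).mul_left (2 * π))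
      gcongr
      rw [norm_smul, norm_pow, norm_real, Real.norm_of_nonneg h0]
      exact mul_le_of_le_one_left (norm_nonneg _) (pow_le_one₀ h0 h1.le)
    have h3 := sum_le_hasSum s (fun n _ => by positivity) hA
    rw [← Finset.mul_sum] at h3
    have h4 : 2 * π * ∑ n ∈ s, ‖(r : ℂ) ^ n • c n‖ ^ 2 ≤ 2 * π * (C * ‖f‖) ^ 2 := by
      calc _ ≤ _ := h3
        _ ≤ _ := hle'
        _ ≤ C ^ 2 * (2 * π * ‖f‖ ^ 2) := by gcongr
        _ = _ := by ring
    have h5 := le_of_mul_le_mul_left h4 (by positivity)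
    simpa only [norm_smul, norm_pow, norm_real, Real.norm_of_nonneg h0] using h5
  have key' : ∀ s : Finset ℕ, ∑ n ∈ s, ‖c n‖ ^ (2 : ENNReal).toReal ≤
      (C * ‖f‖) ^ (2 : ENNReal).toReal := by
    intro s
    have hcont : Continuous fun r : ℝ => ∑ n ∈ s, (r ^ n * ‖c n‖) ^ 2 := by fun_prop
    have ht : Tendsto (fun r : ℝ => ∑ n ∈ s, (r ^ n * ‖c n‖) ^ 2) (𝓝[<] 1)
        (𝓝 (∑ n ∈ s, ((1:ℝ) ^ n * ‖c n‖) ^ 2)) := (hcont.tendsto 1).mono_left nhdsWithin_le_nhds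
    have := le_of_tendsto ht (b := (C * ‖f‖) ^ 2) (by
      filter_upwards [Ioo_mem_nhdsLT (zero_lt_one' ℝ)] with r hr
      exact key r hr.1.le hr.2 s)
    simpa using this
  have hmem : Memℓp c 2 := memℓp_gen' key'
  refine ⟨⟨c, hmem⟩, fun n => rfl, ?_⟩
  refine lp.norm_le_of_forall_sum_le (by norm_num) (by positivity) key'

theorem taylor_hasSum [CompleteSpace E] {g : ℂ → E} (hg : DifferentiableOn ℂ g disc)
    {z : ℂ} (hz : z ∈ disc) :
    HasSum (fun n : ℕ => z ^ n • ((n.factorial : ℂ)⁻¹ • iteratedDeriv n g 0)) (g z) := by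
  have := Complex.hasSum_taylorSeries_on_ball (c := 0) (r := 1) (f := g) (by simpa [disc] using hg)
    (z := z) (by simpa [disc] using hz)
  convert this using 2 with n
  rw [sub_zero, smul_comm]

theorem Hardy.differentiableOn_eval [CompleteSpace E] (f : Hardy E) :
    DifferentiableOn ℂ (Hardy.eval f) disc := by
  intro z hz
  have hz' : ‖z‖ < 1 := by simpa [disc] using hz
  obtain ⟨r, h1, h2⟩ := exists_between hz'
  have hr0 : 0 < r := (norm_nonneg z).trans_lt h1
  have hd : DifferentiableOn ℂ (fun w : ℂ => ∑' n : ℕ, w ^ n • f n) (Metric.ball 0 r) := by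
    refine differentiableOn_tsum_of_summable_norm (u := fun n => r ^ n * ‖f‖)
      ((summable_geometric_of_lt_one hr0.le h2).mul_right _) (fun n => by fun_prop)
      Metric.isOpen_ball fun n w hw => ?_
    rw [norm_smul, norm_pow]
    have : ‖w‖ ≤ r := by simpa using (Metric.mem_ball.1 hw).le
    gcongr
    exact lp.norm_apply_le_norm (by norm_num) f n
  exact ((hd z (by simpa using h1)).differentiableAt
    (Metric.isOpen_ball.mem_nhds (by simpa using h1))).differentiableWithinAt

/-- A bounded holomorphic operator-valued function is a multiplier of the Hardy space. -/
theorem exists_isMultOp [CompleteSpace E] {Φ : ℂ → E →L[ℂ] E} (hΦ : DifferentiableOn ℂ Φ disc)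
    {C : ℝ} (hC : ∀ z ∈ disc, ‖Φ z‖ ≤ C) :
    ∃ M : Hardy E →L[ℂ] Hardy E, IsMultOp Φ M ∧ ‖M‖ ≤ C := by
  have hC0 : 0 ≤ C := (norm_nonneg _).trans (hC 0 (by simp [disc]))
  have hex : ∀ f : Hardy E, ∃ h : Hardy E, (∀ z ∈ disc, Hardy.eval h z = Φ z (Hardy.eval f z)) ∧
      ‖h‖ ≤ C * ‖f‖ := by
    intro f
    have hg : DifferentiableOn ℂ (fun z => Φ z (Hardy.eval f z)) disc :=
      hΦ.clm_apply (Hardy.differentiableOn_eval f)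
    obtain ⟨h, hc, hn⟩ := Hardy.exists_of_norm_le f hC0 (fun z hz => taylor_hasSum hg hz)
      fun z hz => ((Φ z).le_opNorm _).trans (by gcongr; exact hC z hz)
    refine ⟨h, fun z hz => ?_, hn⟩
    rw [← (taylor_hasSum hg hz).tsum_eq, Hardy.eval]
    simp only [hc]
  choose m hm hn using hex
  refine ⟨LinearMap.mkContinuous
    { toFun := m
      map_add' := fun f g => Hardy.eval_injective fun z hz => by
        have h := hm (f + g) z hz
        rw [h, ← Hardy.evalL_apply hz, ← Hardy.evalL_apply hz, map_add, map_add, map_add]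
        simp [hm _ z hz]
      map_smul' := fun c f => Hardy.eval_injective fun z hz => by
        have h := hm (c • f) z hz
        rw [h, ← Hardy.evalL_apply hz, ← Hardy.evalL_apply hz, map_smul, map_smul]
        simp [hm _ z hz] } C hn, fun f z hz => hm f z hz, LinearMap.mkContinuous_norm_le _ hC0 _⟩

end HardySpace

/-! ### Reproducing kernels -/

section Kernel

variable {E : Type*} [NormedAddCommGroup E] [InnerProductSpace ℂ E]

theorem hasSum_sq_norm_kernel {z : ℂ} (hz : z ∈ disc) (v : E) :
    HasSum (fun n => ‖(starRingEnd ℂ) z ^ n • v‖ ^ 2) ((1 - ‖z‖ ^ 2)⁻¹ * ‖v‖ ^ 2) := by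
  have hz' : ‖z‖ < 1 := by simpa [disc] using hz
  have := (hasSum_geometric_of_lt_one (sq_nonneg ‖z‖)
    (pow_lt_one₀ (norm_nonneg z) hz' two_ne_zero)).mul_right (‖v‖ ^ 2)
  have h : (fun n : ℕ => ‖(starRingEnd ℂ) z ^ n • v‖ ^ 2) =
      fun n => (‖z‖ ^ 2) ^ n * ‖v‖ ^ 2 := by
    ext n
    rw [norm_smul, norm_pow, RCLike.norm_conj, mul_pow, ← pow_mul, ← pow_mul, mul_comm 2]
  rw [h]
  exact this

/-- The reproducing kernel `k_z ⊗ v` of the Hardy space. -/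
def Hardy.kernel (z : ℂ) (hz : z ∈ disc) (v : E) : Hardy E :=
  ⟨fun n => (starRingEnd ℂ) z ^ n • v, memℓp_gen (by
    simpa using (hasSum_sq_norm_kernel hz v).summable)⟩

theorem Hardy.norm_sq_kernel {z : ℂ} (hz : z ∈ disc) (v : E) :
    ‖Hardy.kernel z hz v‖ ^ 2 = (1 - ‖z‖ ^ 2)⁻¹ * ‖v‖ ^ 2 :=
  (Hardy.hasSum_sq_norm _).unique (hasSum_sq_norm_kernel hz v)

theorem Hardy.inner_kernel [CompleteSpace E] {z : ℂ} (hz : z ∈ disc) (v : E) (f : Hardy E) :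
    ⟪Hardy.kernel z hz v, f⟫_ℂ = ⟪v, Hardy.eval f z⟫_ℂ := by
  have h1 := lp.hasSum_inner (𝕜 := ℂ) (Hardy.kernel z hz v) f
  have h2 := (innerSL ℂ v).hasSum (Hardy.summable_eval f hz).of_norm.hasSum
  refine h1.unique ?_
  convert h2 using 2 with n
  · simp [Hardy.kernel, inner_smul_left]
  · rfl

theorem IsMultOp.adjoint_kernel [CompleteSpace E] {Φ : ℂ → E →L[ℂ] E} {M : Hardy E →L[ℂ] Hardy E}
    (hM : IsMultOp Φ M) {z : ℂ} (hz : z ∈ disc) (v : E) :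
    adjoint M (Hardy.kernel z hz v) = Hardy.kernel z hz (adjoint (Φ z) v) := by
  refine ext_inner_right ℂ fun f => ?_
  rw [adjoint_inner_left, Hardy.inner_kernel, Hardy.inner_kernel, hM f z hz, adjoint_inner_left]

/-- The adjoint of `M` sends `k_z ⊗ v` to `k_z ⊗ Φ(z)* v`, and the factor `(1 - |z|²)⁻¹` cancels
when norms are compared. -/
theorem IsMultOp.norm_symbol_le [CompleteSpace E] {Φ : ℂ → E →L[ℂ] E}
    {M : Hardy E →L[ℂ] Hardy E} (hM : IsMultOp Φ M) {z : ℂ} (hz : z ∈ disc) : ‖Φ z‖ ≤ ‖M‖ := by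
  have hz' : ‖z‖ < 1 := by simpa [disc] using hz
  have hpos : 0 < (1 - ‖z‖ ^ 2)⁻¹ :=
    inv_pos.2 (sub_pos.2 (pow_lt_one₀ (norm_nonneg z) hz' two_ne_zero))
  rw [← LinearIsometryEquiv.norm_map adjoint (Φ z)]
  refine opNorm_le_bound _ (norm_nonneg _) fun v => ?_
  have h1 : ‖Hardy.kernel z hz (adjoint (Φ z) v)‖ ≤ ‖M‖ * ‖Hardy.kernel z hz v‖ := by
    rw [← hM.adjoint_kernel hz, ← LinearIsometryEquiv.norm_map adjoint M]
    exact le_opNorm _ _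
  have h2 := pow_le_pow_left₀ (norm_nonneg _) h1 2
  rw [mul_pow, Hardy.norm_sq_kernel, Hardy.norm_sq_kernel, mul_left_comm] at h2
  have h3 := le_of_mul_le_mul_left h2 hpos
  rw [← mul_pow] at h3
  exact (pow_le_pow_iff_left₀ (norm_nonneg _) (by positivity) two_ne_zero).1 h3

end Kernel

/-! ### Dilation to the shift and von Neumann's inequality -/

section VonNeumann

variable {E : Type*} [NormedAddCommGroup E] [InnerProductSpace ℂ E] [CompleteSpace E]

/-- Multiplication by `z` is specified by values only; this recovers its action on coefficients,
from which the adjoint is seen to be the backward shift. -/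
theorem IsMultOp.apply_succ_of_smul_id {S : Hardy E →L[ℂ] Hardy E}
    (hS : IsMultOp (fun z => z • ContinuousLinearMap.id ℂ E) S) (f : Hardy E) :
    S f 0 = 0 ∧ ∀ n, S f (n + 1) = f n := by
  obtain ⟨h, hc, -⟩ := Hardy.exists_of_norm_le f zero_le_one
    (c := fun n => Nat.casesOn n 0 fun m => f m) (g := fun z => z • Hardy.eval f z)
    (fun z hz => by
      rw [← hasSum_nat_add_iff' 1]
      simpa [pow_succ', mul_smul, Hardy.eval] using
        (Hardy.summable_eval f hz).of_norm.hasSum.const_smul z)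
    (fun z hz => by
      have hz' : ‖z‖ < 1 := by simpa [disc] using hz
      rw [norm_smul]
      gcongr)
  have : S f = h := Hardy.eval_injective fun z hz => by
    rw [hS f z hz]
    have hs : HasSum (fun n => z ^ n • h n) (z • Hardy.eval f z) := by
      rw [← hasSum_nat_add_iff' 1]
      simpa [hc, pow_succ', mul_smul, Hardy.eval] using
        (Hardy.summable_eval f hz).of_norm.hasSum.const_smul z
    exact hs.tsum_eq.symm
  rw [this]
  exact ⟨hc 0, fun n => hc (n + 1)⟩

/-- A contraction with summable powers is the compression of the shift: the adjoint extends to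
the backward shift. -/
theorem exists_dilation {A : E →L[ℂ] E} (hA : ‖A‖ ≤ 1) (hs : Summable fun n => ‖A ^ n‖)
    {S : Hardy E →L[ℂ] Hardy E}
    (hS : IsMultOp (fun z => z • ContinuousLinearMap.id ℂ E) S) :
    ∃ V : E → Hardy E, (∀ x, ‖V x‖ = ‖x‖) ∧ (∀ x y, ⟪V x, V y⟫_ℂ = ⟪x, y⟫_ℂ) ∧
      ∀ x, adjoint S (V x) = V (adjoint A x) := by
  set B := adjoint A with hB
  have hpos : (0 : E →L[ℂ] E) ≤ 1 - A * B := by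
    rw [nonneg_iff_isPositive, isPositive_iff']
    refine ⟨?_, fun x => ?_⟩
    · rw [hB, ← star_eq_adjoint]
      exact (IsSelfAdjoint.one _).sub (IsSelfAdjoint.mul_star_self A)
    · have hBx : ‖B x‖ ≤ ‖x‖ := by
        have := B.le_opNorm x
        rw [hB, LinearIsometryEquiv.norm_map] at this
        exact this.trans (mul_le_of_le_one_left (norm_nonneg x) hA)
      rw [sub_apply, inner_sub_left, one_apply_eq_self, mul_apply_eq_comp, ← adjoint_inner_right,
        ← hB, inner_self_eq_norm_sq_to_K, inner_self_eq_norm_sq_to_K, sub_nonneg]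
      have := pow_le_pow_left₀ (norm_nonneg _) hBx 2
      exact_mod_cast this
  -- `D` is a defect operator, `D* D = 1 - A A*`. The embedding will be `V x = (D A*ⁿ x)ₙ`: its norm
  -- telescopes to `‖x‖² - lim ‖A*ⁿ x‖² = ‖x‖²`, and shifting the sequence backwards replaces `x` by
  -- `A* x`.
  obtain ⟨D, hD⟩ := CStarAlgebra.nonneg_iff_eq_star_mul_self.1 hpos
  have hD' : ∀ x y, ⟪D x, D y⟫_ℂ = ⟪x, y⟫_ℂ - ⟪B x, B y⟫_ℂ := fun x y => by
    rw [← adjoint_inner_right, ← star_eq_adjoint, ← mul_apply_eq_comp (star D), ← hD, sub_apply, inner_sub_right,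
      one_apply_eq_self, mul_apply_eq_comp, hB, adjoint_inner_left]
  have hB0 : ∀ x, Tendsto (fun n => (B ^ n) x) atTop (𝓝 0) := fun x => by
    refine squeeze_zero_norm (fun n => (B ^ n).le_opNorm x) ?_
    have : ∀ n, ‖B ^ n‖ = ‖A ^ n‖ := fun n => by
      rw [hB, ← star_eq_adjoint, ← star_pow, norm_star]
    simpa [this] using hs.tendsto_atTop_zero.mul_const ‖x‖
  have htel : ∀ x y, Tendsto (fun N => ∑ n ∈ Finset.range N, ⟪D ((B ^ n) x), D ((B ^ n) y)⟫_ℂ)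
      atTop (𝓝 ⟪x, y⟫_ℂ) := fun x y => by
    have : ∀ N, ∑ n ∈ Finset.range N, ⟪D ((B ^ n) x), D ((B ^ n) y)⟫_ℂ =
        ⟪x, y⟫_ℂ - ⟪(B ^ N) x, (B ^ N) y⟫_ℂ := fun N => by
      have h := Finset.sum_range_sub' (fun n => ⟪(B ^ n) x, (B ^ n) y⟫_ℂ) N
      rw [pow_zero, one_apply_eq_self, one_apply_eq_self] at h
      rw [← h]
      refine Finset.sum_congr rfl fun n _ => ?_
      rw [hD', pow_succ', mul_apply_eq_comp, mul_apply_eq_comp]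
    simp only [this]
    have h := (tendsto_const_nhds (x := ⟪x, y⟫_ℂ)).sub ((hB0 x).inner (𝕜 := ℂ) (hB0 y))
    rwa [inner_zero_left, sub_zero] at h
  have hsq : ∀ x, HasSum (fun n => ‖D ((B ^ n) x)‖ ^ 2) (‖x‖ ^ 2) := fun x => by
    rw [hasSum_iff_tendsto_nat_of_nonneg (fun n => by positivity)]
    have := (continuous_re.tendsto _).comp (htel x x)
    simpa [Function.comp_def, inner_self_eq_norm_sq_to_K, ← ofReal_pow] using this
  set V : E → Hardy E := fun x => ⟨fun n => D ((B ^ n) x), memℓp_gen (by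
    simpa using (hsq x).summable)⟩ with hV
  have hin : ∀ x y, ⟪V x, V y⟫_ℂ = ⟪x, y⟫_ℂ := fun x y =>
    tendsto_nhds_unique (lp.hasSum_inner (𝕜 := ℂ) (V x) (V y)).tendsto_sum_nat (htel x y)
  refine ⟨V, fun x => ?_, hin, fun x => ?_⟩
  · rw [@norm_eq_sqrt_re_inner ℂ, hin, ← @norm_eq_sqrt_re_inner ℂ]
  · refine ext_inner_right ℂ fun f => ?_
    obtain ⟨h0, h1⟩ := hS.apply_succ_of_smul_id f
    rw [adjoint_inner_left]
    refine (lp.hasSum_inner (𝕜 := ℂ) (V x) (S f)).unique ?_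
    rw [← hasSum_nat_add_iff' 1]
    simpa [h0, h1, hV, pow_succ] using lp.hasSum_inner (𝕜 := ℂ) (V (B x)) f

/-- **von Neumann's inequality** for a contraction with summable powers. -/
theorem norm_tsum_smul_pow_le {A : E →L[ℂ] E} (hA : ‖A‖ ≤ 1) (hs : Summable fun n => ‖A ^ n‖)
    {a : ℕ → ℂ} {g : ℂ → ℂ} (hg : ∀ w ∈ disc, HasSum (fun n => w ^ n * a n) (g w)) {C : ℝ}
    (hC : ∀ w ∈ disc, ‖g w‖ ≤ C) : ‖∑' n, a n • A ^ n‖ ≤ C ∧ ∀ n, ‖a n‖ ≤ C := by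
  have hC0 : 0 ≤ C := (norm_nonneg _).trans (hC 0 (by simp [disc]))
  have hone : ∀ z, Hardy.eval (lp.single 2 (0 : ℕ) (1 : ℂ) : Hardy ℂ) z = 1 := fun z => by
    rw [Hardy.eval, tsum_eq_single 0 (fun n hn => by simp [lp.single_apply, hn])]
    simp
  -- Comparison with the constant function `1` makes the bounded function `g` an element of `H²`,
  -- which bounds its coefficients.
  obtain ⟨h, hc, hn⟩ := Hardy.exists_of_norm_le (lp.single 2 (0 : ℕ) (1 : ℂ) : Hardy ℂ) hC0
    (c := a) (g := g) (by simpa using hg) (by simpa [hone] using hC)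
  have ha : ∀ n, ‖a n‖ ≤ C := fun n => by
    rw [← hc]
    refine (lp.norm_apply_le_norm (by norm_num) h n).trans (hn.trans ?_)
    rw [lp.norm_single (by norm_num)]; simp
  refine ⟨?_, ha⟩
  have hgd : DifferentiableOn ℂ g disc := (Hardy.differentiableOn_eval h).congr fun z hz => by
    rw [← (hg z hz).tsum_eq, Hardy.eval]; simp [hc]
  obtain ⟨S, hS, hS1⟩ := exists_isMultOp (Φ := fun z => z • ContinuousLinearMap.id ℂ E)
    (C := 1) (by fun_prop) (fun z hz => by
      have hz' : ‖z‖ < 1 := by simpa [disc] using hz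
      rw [norm_smul]
      exact mul_le_one₀ hz'.le (norm_nonneg _) norm_id_le)
  obtain ⟨V, hVn, hVi, hVS⟩ := exists_dilation hA hs hS
  have hVS' : ∀ n x y, ⟪V x, (S ^ n) (V y)⟫_ℂ = ⟪x, (A ^ n) y⟫_ℂ := by
    intro n
    induction n with
    | zero => simpa using hVi
    | succ n ih =>
      intro x y
      rw [pow_succ', pow_succ', mul_apply_eq_comp, mul_apply_eq_comp, ← adjoint_inner_left, hVS, ih,
        adjoint_inner_left]
  have hSeval : ∀ n (f : Hardy E) (z : ℂ), z ∈ disc →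
      Hardy.eval ((S ^ n) f) z = z ^ n • Hardy.eval f z := by
    intro n
    induction n with
    | zero => simp
    | succ n ih =>
      intro f z hz
      rw [pow_succ', mul_apply_eq_comp, hS _ z hz, ih f z hz, pow_succ', mul_smul]
      rfl
  have hSn : ∀ n, ‖S ^ n‖ ≤ 1 := fun n =>
    opNorm_le_bound _ zero_le_one fun f => by
      induction n with
      | zero => simp
      | succ n ih =>
        rw [pow_succ', mul_apply_eq_comp, one_mul]
        exact (le_of_opNorm_le _ hS1 _).trans (by simpa using ih)
  -- Replacing `g(z)` by `g(r z)` makes the series in the shift converge absolutely, to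
  -- multiplication by `g(r z)`, of norm at most `C`. The series in `A` is its compression along
  -- `V`.
  have hdil : ∀ r : ℝ, 0 ≤ r → r < 1 → ‖∑' n, ((r : ℂ) ^ n * a n) • A ^ n‖ ≤ C := by
    intro r h0 h1
    have hrz : ∀ z ∈ disc, (r : ℂ) * z ∈ disc := fun z hz => by
      have hz' : ‖z‖ < 1 := by simpa [disc] using hz
      simpa [disc, abs_of_nonneg h0] using mul_lt_one_of_nonneg_of_lt_one_left h0 h1 hz'.le
    obtain ⟨M, hM, hMC⟩ := exists_isMultOp
      (Φ := fun z => g (r * z) • ContinuousLinearMap.id ℂ E) (C := C)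
      (by
        have : DifferentiableOn ℂ (fun z => g (r * z)) disc :=
          hgd.comp (by fun_prop) hrz
        exact this.smul_const _)
      (fun z hz => by
        rw [norm_smul]
        exact (mul_le_of_le_one_right (norm_nonneg _) norm_id_le).trans (hC _ (hrz z hz)))
    have hsumr : Summable fun n : ℕ => r ^ n * C := (summable_geometric_of_lt_one h0 h1).mul_right _
    have hran : ∀ n, ‖(r : ℂ) ^ n * a n‖ ≤ r ^ n * C := fun n => by
      rw [norm_mul, norm_pow, norm_real, Real.norm_of_nonneg h0]
      gcongr
      exact ha n
    have hsumS : Summable fun n => ((r : ℂ) ^ n * a n) • S ^ n :=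
      Summable.of_norm_bounded hsumr fun n => by
        rw [norm_smul]
        exact (mul_le_of_le_one_right (norm_nonneg _) (hSn n)).trans (hran n)
    have hApow : ∀ n, ‖A ^ n‖ ≤ 1 := fun n => by
      induction n with
      | zero => rw [pow_zero]; exact norm_id_le
      | succ n ih => 
        rw [pow_succ]
        exact (norm_mul_le _ _).trans (mul_le_one₀ ih (norm_nonneg _) hA)
    have hsumA : Summable fun n => ((r : ℂ) ^ n * a n) • A ^ n :=
      Summable.of_norm_bounded hsumr fun n => by
        rw [norm_smul]
        exact (mul_le_of_le_one_right (norm_nonneg _) (hApow n)).trans (hran n)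
    have hMS : M = ∑' n, ((r : ℂ) ^ n * a n) • S ^ n := by
      ext1 f
      refine Hardy.eval_injective fun z hz => ?_
      rw [hM f z hz, ← Hardy.evalL_apply hz ((∑' n, ((r : ℂ) ^ n * a n) • S ^ n) f)]
      have h1 := (Hardy.evalL z hz).hasSum ((ContinuousLinearMap.apply ℂ _ f).hasSum hsumS.hasSum)
      have h2 := (hg _ (hrz z hz)).smul_const (Hardy.eval f z)
      refine (h2.unique ?_)
      convert h1 using 2 with n
      · simp only [apply_apply, map_smul, Hardy.evalL_apply, hSeval n f z hz, smul_smul]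
        congr 1; ring
      · rfl
    refine opNorm_le_of_re_inner_le hC0 fun x y hx hy => ?_
    have h1 := (innerSL ℂ y).hasSum ((ContinuousLinearMap.apply ℂ _ x).hasSum hsumA.hasSum)
    have h2 := (innerSL ℂ (V y)).hasSum
      ((ContinuousLinearMap.apply ℂ _ (V x)).hasSum hsumS.hasSum)
    simp only [apply_apply, map_smul, innerSL_apply_apply, hVS'] at h1 h2
    rw [← inner_conj_symm, RCLike.conj_re, h1.unique h2, ← hMS]
    calc _ ≤ ‖⟪V y, M (V x)⟫_ℂ‖ := RCLike.re_le_norm _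
      _ ≤ ‖V y‖ * ‖M (V x)‖ := norm_inner_le_norm _ _
      _ ≤ ‖V y‖ * (C * ‖V x‖) := by gcongr; exact M.le_of_opNorm_le hMC _
      _ = C := by rw [hVn, hVn, hx, hy]; ring
  have hlim : Tendsto (fun r : ℝ => ∑' n, ((r : ℂ) ^ n * a n) • A ^ n) (𝓝[<] 1)
      (𝓝 (∑' n, a n • A ^ n)) := by
    refine tendsto_tsum_of_dominated_convergence (bound := fun n => C * ‖A ^ n‖)
      (hs.mul_left C) (fun n => ?_) ?_
    · have : Continuous fun r : ℝ => ((r : ℂ) ^ n * a n) • A ^ n := by fun_prop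
      simpa using (this.tendsto 1).mono_left nhdsWithin_le_nhds
    · filter_upwards [Ioo_mem_nhdsLT (zero_lt_one' ℝ)] with r hr n
      rw [norm_smul]
      gcongr
      rw [norm_mul, norm_pow, norm_real, Real.norm_of_nonneg hr.1.le]
      exact (mul_le_of_le_one_left (norm_nonneg _) (pow_le_one₀ hr.1.le hr.2.le)).trans (ha n)
  refine le_of_tendsto hlim.norm ?_
  filter_upwards [Ioo_mem_nhdsLT (zero_lt_one' ℝ)] with r hr
  exact hdil r hr.1.le hr.2

end VonNeumann

/-! ### Holomorphic dependence of integrals on a parameter -/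

section ParametricIntegral

/-- A parametric integral of uniformly bounded holomorphic functions is holomorphic. -/
theorem differentiableAt_integral_of_bounded {α X : Type*} [MeasurableSpace α] {μ : Measure α}
    [IsFiniteMeasure μ] [NormedAddCommGroup X] [NormedSpace ℂ X] [FiniteDimensional ℂ X]
    {F : X → α → ℂ} {U : Set X} (hU : IsOpen U)
    {B : ℝ} (hB : ∀ p ∈ U, ∀ a, ‖F p a‖ ≤ B) (hd : ∀ a, DifferentiableOn ℂ (F · a) U)
    (hm : ∀ p ∈ U, AEStronglyMeasurable (F p) μ) {p₀ : X} (hp : p₀ ∈ U) :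
    DifferentiableAt ℂ (fun p => ∫ a, F p a ∂μ) p₀ := by
  obtain ⟨ε, hε, hball⟩ := Metric.isOpen_iff.1 hU p₀ hp
  -- A Schwarz-type estimate turns the uniform bound on `F` into a uniform bound on its derivative,
  -- the domination needed to differentiate under the integral.
  have hbound : ∀ a, ∀ p ∈ Metric.ball p₀ (ε / 2), ‖fderiv ℂ (F · a) p‖ ≤ (2 * B) / (ε / 2) := by
    intro a p hp'
    have hsub : Metric.ball p (ε / 2) ⊆ U := by
      refine subset_trans (Metric.ball_subset_ball' ?_) hball
      have := Metric.mem_ball.1 hp'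
      linarith
    refine Complex.norm_fderiv_le_div_of_mapsTo_ball ((hd a).mono hsub) (fun q hq => ?_)
      (half_pos hε)
    rw [Metric.mem_closedBall, dist_eq_norm]
    calc _ ≤ ‖F q a‖ + ‖F p a‖ := norm_sub_le _ _
      _ ≤ B + B := add_le_add (hB _ (hsub hq) a)
          (hB _ (hsub (Metric.mem_ball_self (half_pos hε))) a)
      _ = 2 * B := by ring
  have hdiff : ∀ a, ∀ p ∈ Metric.ball p₀ (ε / 2), HasFDerivAt (F · a) (fderiv ℂ (F · a) p) p :=
    fun a p hp' => ((hd a).differentiableAt (hU.mem_nhds (hball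
      (Metric.ball_subset_ball (by linarith) hp')))).hasFDerivAt
  -- Each directional derivative is a limit of measurable difference quotients, and a finite basis
  -- reassembles the full derivative. The index shift by `N` keeps every sampled point in `U`.
  have hmeas : AEStronglyMeasurable (fun a => fderiv ℂ (F · a) p₀) μ := by
    have hv : ∀ v : X, AEStronglyMeasurable (fun a => fderiv ℂ (F · a) p₀ v) μ := by
      intro v
      have hc : Tendsto (fun n : ℕ => ‖(n : ℂ)‖) atTop atTop := by
        simpa using tendsto_natCast_atTop_atTop (R := ℝ)
      have hlim : Tendsto (fun n : ℕ => p₀ + (n : ℂ)⁻¹ • v) atTop (𝓝 p₀) := by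
        have : Tendsto (fun n : ℕ => (n : ℂ)⁻¹) atTop (𝓝 0) :=
          tendsto_inv₀_cobounded.comp (tendsto_norm_atTop_iff_cobounded.1 hc)
        simpa using (this.smul_const v).const_add p₀
      obtain ⟨N, hN⟩ := eventually_atTop.1 (hlim.eventually (hU.mem_nhds hp))
      refine aestronglyMeasurable_of_tendsto_ae atTop
        (f := fun (n : ℕ) a => ((n + N : ℕ) : ℂ) • (F (p₀ + ((n + N : ℕ) : ℂ)⁻¹ • v) a - F p₀ a))
        (fun n => ((hm _ (hN (n + N) (Nat.le_add_left _ _))).sub (hm _ hp)).const_smul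
          ((n + N : ℕ) : ℂ))
        (ae_of_all _ fun a => ?_)
      exact ((hdiff a p₀ (Metric.mem_ball_self (half_pos hε))).lim v hc).comp
        (tendsto_add_atTop_nat N)
    set b := Module.finBasis ℂ X
    have hrepr : ∀ L : X →L[ℂ] ℂ, L = ∑ i, L (b i) • (LinearMap.toContinuousLinearMap (b.coord i)) :=
      fun L => by
        ext x
        conv_lhs => rw [← b.sum_repr x]
        simp only [map_sum, map_smul, sum_apply, smul_apply,
          LinearMap.coe_toContinuousLinearMap', Module.Basis.coord_apply, smul_eq_mul]
        exact Finset.sum_congr rfl fun i _ => mul_comm _ _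
    rw [show (fun a => fderiv ℂ (F · a) p₀) = fun a => ∑ i, fderiv ℂ (F · a) p₀ (b i) •
      (LinearMap.toContinuousLinearMap (b.coord i)) from funext fun a => hrepr _]
    exact Finset.aestronglyMeasurable_fun_sum _ fun i _ => (hv (b i)).smul_const _
  refine (hasFDerivAt_integral_of_dominated_of_fderiv_le
    (F' := fun p a => fderiv ℂ (F · a) p) (bound := fun _ => (2 * B) / (ε / 2))
    (Metric.ball_mem_nhds p₀ (half_pos hε)) ?_ ?_ hmeas (ae_of_all _ hbound)
    (integrable_const _) (ae_of_all _ hdiff)).differentiableAt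
  · filter_upwards [hU.mem_nhds hp] with p hp' using hm p hp'
  · exact Integrable.of_bound (hm _ hp) B (ae_of_all _ (hB p₀ hp))

end ParametricIntegral

/-! ### Division in `H^∞(𝔻²)` -/

section HInf

variable {f g : ℂ × ℂ → ℂ}

theorem isOpen_disc : IsOpen disc := Metric.isOpen_ball

theorem isOpen_bidisc : IsOpen bidisc := isOpen_disc.prod isOpen_disc

theorem mem_disc_iff {z : ℂ} : z ∈ disc ↔ ‖z‖ < 1 := by simp [disc]

theorem HInf.add (hf : f ∈ HInf) (hg : g ∈ HInf) : (fun p => f p + g p) ∈ HInf := by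
  obtain ⟨C, hC⟩ := hf.2
  obtain ⟨D, hD⟩ := hg.2
  exact ⟨hf.1.add hg.1, C + D, fun p hp =>
    (norm_add_le _ _).trans (add_le_add (hC p hp) (hD p hp))⟩

theorem HInf.mul (hf : f ∈ HInf) (hg : g ∈ HInf) : (fun p => f p * g p) ∈ HInf := by
  obtain ⟨C, hC⟩ := hf.2
  obtain ⟨D, hD⟩ := hg.2
  exact ⟨hf.1.mul hg.1, C * D, fun p hp => by
    rw [norm_mul]
    exact mul_le_mul (hC p hp) (hD p hp) (norm_nonneg _) ((norm_nonneg _).trans (hC p hp))⟩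

theorem HInf.const (c : ℂ) : (fun _ => c) ∈ HInf :=
  ⟨by fun_prop, ‖c‖, fun _ _ => le_rfl⟩

theorem HInf.fst : (fun p : ℂ × ℂ => p.1) ∈ HInf :=
  ⟨by fun_prop, 1, fun _ hp => (mem_disc_iff.1 hp.1).le⟩

theorem HInf.snd : (fun p : ℂ × ℂ => p.2) ∈ HInf :=
  ⟨by fun_prop, 1, fun _ hp => (mem_disc_iff.1 hp.2).le⟩

theorem HInf.sub (hf : f ∈ HInf) (hg : g ∈ HInf) : (fun p => f p - g p) ∈ HInf := by
  convert HInf.add hf (HInf.mul (HInf.const (-1)) hg) using 2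
  ring

theorem HInf.comp_swap (hf : f ∈ HInf) : (fun p => f p.swap) ∈ HInf := by
  obtain ⟨C, hC⟩ := hf.2
  have hs : ∀ p ∈ bidisc, Prod.swap p ∈ bidisc := fun p hp => ⟨hp.2, hp.1⟩
  exact ⟨hf.1.comp (by fun_prop : DifferentiableOn ℂ (fun p : ℂ × ℂ => (p.2, p.1)) bidisc) hs,
    C, fun p hp => hC _ (hs p hp)⟩

theorem HInf.slice_fst (hf : f ∈ HInf) {w : ℂ} (hw : w ∈ disc) :
    DifferentiableOn ℂ (fun z => f (z, w)) disc :=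
  hf.1.comp (by fun_prop) fun _ hz => ⟨hz, hw⟩

theorem HInf.slice_snd (hf : f ∈ HInf) {z : ℂ} (hz : z ∈ disc) :
    DifferentiableOn ℂ (fun w => f (z, w)) disc :=
  hf.1.comp (by fun_prop) fun _ hw => ⟨hz, hw⟩

/-- Boundedness follows from a Schwarz estimate near `z = l` and from the size of the denominator
elsewhere. Joint holomorphy is in doubt only on the slice `z = l`, where Cauchy's formula in `z`
gives a parametric integral over a circle avoiding the slice. -/
theorem HInf.dslope_fst (hf : f ∈ HInf) {l : ℂ} (hl : l ∈ disc) :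
    (fun p : ℂ × ℂ => dslope (fun ζ => f (ζ, p.2)) l p.1) ∈ HInf := by
  obtain ⟨C, hC⟩ := hf.2
  have hl' := mem_disc_iff.1 hl
  set δ := 1 - ‖l‖ with hδ
  have hδ0 : 0 < δ := by linarith
  have hsub : Metric.ball l δ ⊆ disc := by
    refine Metric.ball_subset_ball' ?_
    rw [dist_zero_right, hδ]; linarith
  have hdiff : ∀ p ∈ bidisc, ‖f p - f (l, p.2)‖ ≤ 2 * C := fun p hp => by
    calc _ ≤ ‖f p‖ + ‖f (l, p.2)‖ := norm_sub_le _ _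
      _ ≤ C + C := add_le_add (hC _ hp) (hC _ ⟨hl, hp.2⟩)
      _ = 2 * C := by ring
  have hbd : ∀ p ∈ bidisc, ‖dslope (fun ζ => f (ζ, p.2)) l p.1‖ ≤ 2 * C / δ := by
    intro p hp
    by_cases h : p.1 ∈ Metric.ball l δ
    · refine norm_dslope_le_div_of_mapsTo_ball ((HInf.slice_fst hf hp.2).mono hsub)
        (fun ζ hζ => ?_) h
      rw [Metric.mem_closedBall, dist_eq_norm]
      exact hdiff (ζ, p.2) ⟨hsub hζ, hp.2⟩
    · have h2 : δ ≤ ‖p.1 - l‖ := by simpa [dist_eq_norm] using h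
      have hne : p.1 ≠ l := by
        rintro h'
        rw [h', sub_self, norm_zero] at h2
        linarith
      rw [dslope_of_ne _ hne, slope_def_field, norm_div]
      have := hdiff p hp
      gcongr
      exact (norm_nonneg _).trans this
  refine ⟨fun p hp => ?_, _, hbd⟩
  refine DifferentiableAt.differentiableWithinAt ?_
  by_cases hne : p.1 = l
  -- The circle of radius `ρ` stays inside the disc, and the evaluation points, within `ρ / 2` of
  -- `l`, keep distance at least `ρ / 2` from it.
  · set ρ := δ / 2 with hρ
    have hρ0 : 0 < ρ := half_pos hδ0
    have hclosed : Metric.closedBall l ρ ⊆ disc :=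
      (Metric.closedBall_subset_ball (by linarith)).trans hsub
    set U : Set (ℂ × ℂ) := Metric.ball l (ρ / 2) ×ˢ disc with hU
    have hUo : IsOpen U := Metric.isOpen_ball.prod isOpen_disc
    have hpU : p ∈ U := ⟨by rw [hne]; exact Metric.mem_ball_self (by linarith), hp.2⟩
    set F : ℂ × ℂ → ℝ → ℂ := fun q θ => deriv (circleMap l ρ) θ •
      ((circleMap l ρ θ - q.1)⁻¹ •
        dslope (fun ζ => f (ζ, q.2)) l (circleMap l ρ θ)) with hF
    have hmem : ∀ θ, circleMap l ρ θ ∈ disc := fun θ =>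
      hclosed (circleMap_mem_closedBall l hρ0.le θ)
    have hne' : ∀ θ, circleMap l ρ θ ≠ l := fun θ => circleMap_ne_center hρ0.ne'
    have hfar : ∀ q ∈ U, ∀ θ, ρ / 2 ≤ ‖circleMap l ρ θ - q.1‖ := by
      intro q hq θ
      have h1 : ‖circleMap l ρ θ - l‖ = ρ := by
        simp [circleMap, abs_of_pos hρ0]
      have h2 : ‖q.1 - l‖ < ρ / 2 := by simpa [dist_eq_norm] using hq.1
      have h3 : ‖circleMap l ρ θ - l‖ ≤ ‖circleMap l ρ θ - q.1‖ + ‖q.1 - l‖ :=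
        norm_sub_le_norm_sub_add_norm_sub _ _ _
      linarith
    have hfar0 : ∀ q ∈ U, ∀ θ, circleMap l ρ θ - q.1 ≠ 0 := fun q hq θ =>
      norm_pos_iff.1 ((half_pos hρ0).trans_le (hfar q hq θ))
    have hcauchy : ∀ q ∈ U, dslope (fun ζ => f (ζ, q.2)) l q.1 =
        (2 * π * I : ℂ)⁻¹ • ∫ θ in Set.Ioc 0 (2 * π), F q θ := by
      intro q hq
      have hdd : DifferentiableOn ℂ (dslope (fun ζ => f (ζ, q.2)) l) (Metric.closedBall l ρ) :=
        ((differentiableOn_dslope (isOpen_disc.mem_nhds hl)).2 (HInf.slice_fst hf hq.2)).mono hclosed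
      have := hdd.circleIntegral_sub_inv_smul
        (Metric.ball_subset_ball (by linarith) hq.1)
      rw [circleIntegral, intervalIntegral.integral_of_le (by positivity)] at this
      rw [eq_inv_smul_iff₀ (by simp [Real.pi_ne_zero])]
      exact this.symm
    have hD := differentiableAt_integral_of_bounded (μ := volume.restrict (Set.Ioc 0 (2 * π)))
      (F := F) hUo (B := ρ * ((ρ / 2)⁻¹ * (2 * C / δ))) ?_ ?_ ?_ hpU
    · refine ((hD.const_smul (2 * π * I : ℂ)⁻¹).congr_of_eventuallyEq ?_)
      filter_upwards [hUo.mem_nhds hpU] with q hq using hcauchy q hq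
    · intro q hq θ
      have h1 : ‖deriv (circleMap l ρ) θ‖ = ρ := by simp [deriv_circleMap, abs_of_pos hρ0]
      rw [hF]
      simp only [norm_smul, h1, norm_inv]
      gcongr
      · exact hfar q hq θ
      · exact hbd (circleMap l ρ θ, q.2) ⟨hmem θ, hq.2⟩
    · intro θ
      simp only [hF, dslope_of_ne _ (hne' θ), slope_def_field, div_eq_mul_inv]
      have h1 : DifferentiableOn ℂ (fun q : ℂ × ℂ => f (circleMap l ρ θ, q.2)) U :=
        (HInf.slice_snd hf (hmem θ)).comp differentiableOn_snd fun q hq => hq.2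
      have h2 : DifferentiableOn ℂ (fun q : ℂ × ℂ => f (l, q.2)) U :=
        (HInf.slice_snd hf hl).comp differentiableOn_snd fun q hq => hq.2
      have h3 : DifferentiableOn ℂ (fun q : ℂ × ℂ => (circleMap l ρ θ - q.1)⁻¹) U :=
        DifferentiableOn.inv (by fun_prop) fun q hq => hfar0 q hq θ
      exact (h3.smul ((h1.sub h2).mul_const (circleMap l ρ θ - l)⁻¹)).const_smul (deriv (circleMap l ρ) θ)
    · intro q hq
      refine Continuous.aestronglyMeasurable ?_
      have h1 : Continuous fun θ => dslope (fun ζ => f (ζ, q.2)) l (circleMap l ρ θ) :=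
        (((differentiableOn_dslope (isOpen_disc.mem_nhds hl)).2
          (HInf.slice_fst hf hq.2)).continuousOn).comp_continuous (continuous_circleMap l ρ) hmem
      have h2 : Continuous fun θ => (circleMap l ρ θ - q.1)⁻¹ :=
        ((continuous_circleMap l ρ).sub continuous_const).inv₀ (hfar0 q hq)
      have h3 : Continuous fun θ => deriv (circleMap l ρ) θ := by
        simp only [deriv_circleMap]
        have := continuous_circleMap 0 ρ
        fun_prop
      exact h3.smul (h2.smul h1)
  · have hev : (fun p : ℂ × ℂ => dslope (fun ζ => f (ζ, p.2)) l p.1) =ᶠ[𝓝 p]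
        fun p => (f p - f (l, p.2)) * (p.1 - l)⁻¹ := by
      filter_upwards [continuous_fst.continuousAt.eventually_ne hne] with q hq
      rw [dslope_of_ne _ hq, slope_def_field, div_eq_mul_inv]
    refine DifferentiableAt.congr_of_eventuallyEq ?_ hev
    have h1 : DifferentiableAt ℂ f p := hf.1.differentiableAt (isOpen_bidisc.mem_nhds hp)
    have h2 : DifferentiableAt ℂ (fun q : ℂ × ℂ => f (l, q.2)) p :=
      ((HInf.slice_snd hf hl).differentiableAt (isOpen_disc.mem_nhds hp.2)).comp p differentiableAt_snd
    have h3 : DifferentiableAt ℂ (fun q : ℂ × ℂ => q.1 - l) p := by fun_prop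
    exact (h1.sub h2).mul (h3.inv (sub_ne_zero.2 hne))

theorem HInf.exists_sub_eq_fst (hf : f ∈ HInf) {l : ℂ} (hl : l ∈ disc) :
    ∃ g ∈ HInf, ∀ p ∈ bidisc, f p - f (l, p.2) = (p.1 - l) * g p := by
  refine ⟨_, HInf.dslope_fst hf hl, fun p _ => ?_⟩
  have := sub_smul_dslope (fun ζ => f (ζ, p.2)) l p.1
  simpa using this.symm

theorem HInf.exists_sub_eq_snd (hf : f ∈ HInf) {m : ℂ} (hm : m ∈ disc) :
    ∃ g ∈ HInf, ∀ p ∈ bidisc, f p - f (p.1, m) = (p.2 - m) * g p := by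
  obtain ⟨g, hg, h⟩ := HInf.exists_sub_eq_fst (HInf.comp_swap hf) hm
  exact ⟨_, HInf.comp_swap hg, fun p hp => by simpa using h p.swap ⟨hp.2, hp.1⟩⟩

/-- Gleason's division property at a point of the bidisc. -/
theorem HInf.exists_sub_eq (hf : f ∈ HInf) {a : ℂ × ℂ} (ha : a ∈ bidisc) :
    ∃ g ∈ HInf, ∃ h ∈ HInf, ∀ p ∈ bidisc,
      f p - f a = (p.1 - a.1) * g p + (p.2 - a.2) * h p := by
  obtain ⟨g, hg, h1⟩ := HInf.exists_sub_eq_fst hf ha.1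
  obtain ⟨h, hh, h2⟩ := HInf.exists_sub_eq_snd hf ha.2
  -- The passage from `p` to `a` goes through the intermediate point `(a.1, p.2)`.
  refine ⟨g, hg, fun p => h (a.1, p.2), ⟨?_, ?_⟩, fun p hp => ?_⟩
  · exact (HInf.slice_snd hh ha.1).comp differentiableOn_snd fun q hq => hq.2
  · obtain ⟨C, hC⟩ := hh.2
    exact ⟨C, fun p hp => hC _ ⟨ha.1, hp.2⟩⟩
  · have e1 := h1 p hp
    have e2 := h2 (a.1, p.2) ⟨ha.1, hp.2⟩
    simp only [Prod.mk.eta] at e2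
    rw [← e1, ← e2]; ring

end HInf

/-! ### Taylor coefficients in the second variable -/

section Coefficients

variable {f g : ℂ × ℂ → ℂ}

/-- The Taylor coefficients at `0` of `f(z, ·)`. -/
def coeff (f : ℂ × ℂ → ℂ) (n : ℕ) (z : ℂ) : ℂ :=
  (n.factorial : ℂ)⁻¹ * iteratedDeriv n (fun w => f (z, w)) 0

theorem HInf.hasSum_coeff (hf : f ∈ HInf) {z w : ℂ} (hz : z ∈ disc) (hw : w ∈ disc) :
    HasSum (fun n => w ^ n * coeff f n z) (f (z, w)) :=
  taylor_hasSum (HInf.slice_snd hf hz) hw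

/-- Both coefficient sequences define elements of `H²`, since the sum is bounded, and these have the
same values in the disc. -/
theorem coeff_eq_of_hasSum (hf : f ∈ HInf) {z : ℂ} (hz : z ∈ disc) {a : ℕ → ℂ}
    (ha : ∀ w ∈ disc, HasSum (fun n => w ^ n * a n) (f (z, w))) (n : ℕ) : coeff f n z = a n := by
  obtain ⟨C, hC⟩ := hf.2
  have hC0 : 0 ≤ C := (norm_nonneg _).trans (hC (0, 0) ⟨by simp [disc], by simp [disc]⟩)
  have hone : ∀ z, Hardy.eval (lp.single 2 (0 : ℕ) (1 : ℂ) : Hardy ℂ) z = 1 := fun z => by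
    rw [Hardy.eval, tsum_eq_single 0 (fun n hn => by simp [lp.single_apply, hn])]
    simp
  obtain ⟨h, hc, -⟩ := Hardy.exists_of_norm_le (lp.single 2 (0 : ℕ) (1 : ℂ) : Hardy ℂ) hC0
    (c := a) (g := fun w => f (z, w)) (by simpa using ha)
    (by simpa [hone] using fun w hw => hC (z, w) ⟨hz, hw⟩)
  obtain ⟨h', hc', -⟩ := Hardy.exists_of_norm_le (lp.single 2 (0 : ℕ) (1 : ℂ) : Hardy ℂ) hC0
    (c := fun n => coeff f n z) (g := fun w => f (z, w))
    (by simpa using fun w hw => HInf.hasSum_coeff hf hz hw)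
    (by simpa [hone] using fun w hw => hC (z, w) ⟨hz, hw⟩)
  have : h = h' := Hardy.eval_injective fun w hw => by
    simp only [Hardy.eval, hc, hc', smul_eq_mul]
    rw [(ha w hw).tsum_eq, (HInf.hasSum_coeff hf hz hw).tsum_eq]
  rw [← hc, ← hc', this]

/-- The coefficient of index `n + 1` of `f` is the one of index `n` of `(f(z, w) - f(z, 0)) / w`,
which is again in `H^∞(𝔻²)`. -/
theorem HInf.differentiableOn_coeff (hf : f ∈ HInf) (n : ℕ) :
    DifferentiableOn ℂ (coeff f n) disc := by
  have h0 : (0 : ℂ) ∈ disc := by simp [disc]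
  induction n generalizing f with
  | zero => exact (HInf.slice_fst hf h0).congr fun z hz => by simp [coeff]
  | succ n ih =>
    obtain ⟨g, hg, h⟩ := HInf.exists_sub_eq_snd hf h0
    refine (ih hg).congr fun z hz => ?_
    refine coeff_eq_of_hasSum hf hz (a := fun k => Nat.casesOn k (f (z, 0)) fun m => coeff g m z)
      (fun w hw => ?_) (n + 1)
    rw [← hasSum_nat_add_iff' 1]
    have h1 := (HInf.hasSum_coeff hg hz hw).mul_left w
    have h2 := h (z, w) ⟨hz, hw⟩
    simp only [sub_zero] at h2
    rw [← h2] at h1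
    simpa [pow_succ', mul_assoc] using h1

theorem coeff_add (hf : f ∈ HInf) (hg : g ∈ HInf) {z : ℂ} (hz : z ∈ disc) (n : ℕ) :
    coeff (fun p => f p + g p) n z = coeff f n z + coeff g n z :=
  coeff_eq_of_hasSum (HInf.add hf hg) hz (a := fun n => coeff f n z + coeff g n z) (fun w hw => by
    simpa [mul_add] using (HInf.hasSum_coeff hf hz hw).add (HInf.hasSum_coeff hg hz hw)) n

theorem coeff_mul (hf : f ∈ HInf) (hg : g ∈ HInf) {z : ℂ} (hz : z ∈ disc) (n : ℕ) :
    coeff (fun p => f p * g p) n z =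
      ∑ kl ∈ Finset.HasAntidiagonal.antidiagonal n, coeff f kl.1 z * coeff g kl.2 z :=
  coeff_eq_of_hasSum (HInf.mul hf hg) hz
    (a := fun n => ∑ kl ∈ Finset.HasAntidiagonal.antidiagonal n, coeff f kl.1 z * coeff g kl.2 z)
    (fun w hw => by
    have h1 := HInf.hasSum_coeff hf hz hw
    have h2 := HInf.hasSum_coeff hg hz hw
    have h3 := tsum_mul_tsum_eq_tsum_sum_antidiagonal_of_summable_norm
      h1.summable.norm h2.summable.norm
    have h4 := summable_norm_sum_mul_antidiagonal_of_summable_norm h1.summable.norm h2.summable.norm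
    rw [h1.tsum_eq, h2.tsum_eq] at h3
    rw [h3]
    have hfun : ∀ n, w ^ n * ∑ kl ∈ Finset.HasAntidiagonal.antidiagonal n,
        coeff f kl.1 z * coeff g kl.2 z = ∑ kl ∈ Finset.HasAntidiagonal.antidiagonal n,
          w ^ kl.1 * coeff f kl.1 z * (w ^ kl.2 * coeff g kl.2 z) := fun n => by
      rw [Finset.mul_sum]
      refine Finset.sum_congr rfl fun kl hkl => ?_
      rw [← Finset.HasAntidiagonal.mem_antidiagonal.1 hkl, pow_add]; ring
    simp only [hfun]
    exact h4.of_norm.hasSum) n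

theorem coeff_congr (h : ∀ p ∈ bidisc, f p = g p) {z : ℂ} (hz : z ∈ disc) (n : ℕ) :
    coeff f n z = coeff g n z := by
  have : (fun w => f (z, w)) =ᶠ[𝓝 0] fun w => g (z, w) := by
    filter_upwards [isOpen_disc.mem_nhds (show (0 : ℂ) ∈ disc by simp [disc])] with w hw
    exact h _ ⟨hz, hw⟩
  rw [coeff, coeff, this.iteratedDeriv_eq]

end Coefficients

/-! ### Geometric decay of matrix powers -/

section PowerBounds

variable {E : Type*} [NormedAddCommGroup E] [InnerProductSpace ℂ E]

/-- Some power of an operator with eigenvalues in the open disc is a strict contraction. -/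
theorem exists_norm_pow_lt_one [FiniteDimensional ℂ E] {A : E →L[ℂ] E}
    (hA : ∀ w : ℂ, Module.End.HasEigenvalue (A : E →ₗ[ℂ] E) w → ‖w‖ < 1) :
    ∃ N : ℕ, 0 < N ∧ ‖A ^ N‖ < 1 := by
  have : CompleteSpace E := FiniteDimensional.complete ℂ E
  rcases subsingleton_or_nontrivial E with hE | hE
  · exact ⟨1, one_pos, by rw [Subsingleton.elim (A ^ 1) 0]; simp⟩
  have hspec : spectralRadius ℂ A < (1 : NNReal) := by
    refine spectrum.spectralRadius_lt_of_forall_lt A fun w hw => ?_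
    have h1 : w ∈ spectrum ℂ (A : E →ₗ[ℂ] E) := by
      have := AlgEquiv.spectrum_eq (Module.End.toContinuousLinearMap E : _ ≃ₐ[ℂ] (E →L[ℂ] E))
        (A : E →ₗ[ℂ] E)
      rw [← this]
      exact hw
    exact hA w (Module.End.hasEigenvalue_iff_mem_spectrum.2 h1)
  -- Gelfand's formula turns spectral radius below `1` into a power of norm below `1`.
  have hlim := spectrum.pow_nnnorm_pow_one_div_tendsto_nhds_spectralRadius A
  obtain ⟨N, hN, hN0⟩ := ((hlim.eventually (gt_mem_nhds hspec)).and (eventually_gt_atTop 0)).exists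
  refine ⟨N, hN0, ?_⟩
  by_contra! h
  refine absurd hN (not_lt.2 ?_)
  refine ENNReal.one_le_rpow ?_ (by positivity)
  exact_mod_cast h

/-- Division of `n` by `N` with remainder; the constant `(s ^ N)⁻¹` pays for the remainder, which is
less than `N`. -/
theorem norm_pow_le_geometric {A : E →L[ℂ] E} (hA : ‖A‖ ≤ 1) {N : ℕ} (hN : 0 < N) {s : ℝ}
    (hs0 : 0 < s) (hs1 : s < 1) (h : ‖A ^ N‖ ≤ s ^ N) (n : ℕ) : ‖A ^ n‖ ≤ (s ^ N)⁻¹ * s ^ n := by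
  have hpow : ∀ n, ‖A ^ n‖ ≤ 1 := fun n => by
    induction n with
    | zero => rw [pow_zero]; exact norm_id_le
    | succ n ih =>
      rw [pow_succ]
      exact (norm_mul_le _ _).trans (mul_le_one₀ ih (norm_nonneg _) hA)
  have hpowN : ∀ k, ‖(A ^ N) ^ k‖ ≤ (s ^ N) ^ k := fun k => by
    induction k with
    | zero => rw [pow_zero, pow_zero]; exact norm_id_le
    | succ k ih =>
      rw [pow_succ, pow_succ]
      exact (norm_mul_le _ _).trans (mul_le_mul ih h (norm_nonneg _) (by positivity))
  have hdm := Nat.div_add_mod n N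
  calc ‖A ^ n‖ = ‖(A ^ N) ^ (n / N) * A ^ (n % N)‖ := by rw [← pow_mul, ← pow_add, hdm]
    _ ≤ (s ^ N) ^ (n / N) * 1 :=
      (norm_mul_le _ _).trans (mul_le_mul (hpowN _) (hpow _) (norm_nonneg _) (by positivity))
    _ ≤ (s ^ N) ^ (n / N) * ((s ^ N)⁻¹ * s ^ (n % N)) := by
      gcongr
      rw [← div_eq_inv_mul, one_le_div (by positivity)]
      exact pow_le_pow_of_le_one hs0.le hs1.le (Nat.mod_lt _ hN).le
    _ = (s ^ N)⁻¹ * s ^ n := by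
      conv_rhs => rw [← hdm, pow_add, pow_mul]
      ring

end PowerBounds

/-! ### The functional calculus of the model pair -/

section Calculus

variable {d : ℕ} {Ψ : ℂ → Cd d →L[ℂ] Cd d} {f g : ℂ × ℂ → ℂ} {z : ℂ}

theorem isMultOp_multOp {Φ : ℂ → Cd d →L[ℂ] Cd d} (hΦ : DifferentiableOn ℂ Φ disc)
    {C : ℝ} (hC : ∀ z ∈ disc, ‖Φ z‖ ≤ C) : IsMultOp Φ (multOp Φ) := by
  obtain ⟨M, hM, -⟩ := exists_isMultOp hΦ hC
  rwa [multOp_eq hM]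

theorem isMultOp_shift : IsMultOp (fun z => z • ContinuousLinearMap.id ℂ (Cd d)) shift :=
  isMultOp_multOp (C := 1) (by fun_prop) fun z hz => by
    rw [norm_smul]
    exact mul_le_one₀ (mem_disc_iff.1 hz).le (norm_nonneg _) norm_id_le

namespace IsRationalPureInner

theorem isMultOp (hΨ : IsRationalPureInner Ψ) : IsMultOp Ψ (multOp Ψ) := by
  obtain ⟨C, hC⟩ := hΨ.bounded
  exact isMultOp_multOp hΨ.holomorphic hC

theorem norm_le_one (hΨ : IsRationalPureInner Ψ) (hz : z ∈ disc) : ‖Ψ z‖ ≤ 1 :=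
  (hΨ.isMultOp.norm_symbol_le hz).trans
    (opNorm_le_bound _ zero_le_one fun f => by rw [hΨ.inner, one_mul])

theorem norm_eigenvalue_lt_one (hΨ : IsRationalPureInner Ψ) (hz : z ∈ disc) {w : ℂ}
    (hw : Module.End.HasEigenvalue (Ψ z : Cd d →ₗ[ℂ] Cd d) w) : ‖w‖ < 1 := by
  refine lt_of_le_of_ne ?_ (hΨ.pure z hz w hw)
  obtain ⟨v, hv⟩ := hw.exists_hasEigenvector
  have h1 : Ψ z v = w • v := hv.apply_eq_smul
  have h2 : ‖w‖ * ‖v‖ ≤ 1 * ‖v‖ := by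
    rw [← norm_smul, ← h1]
    exact (Ψ z).le_of_opNorm_le (hΨ.norm_le_one hz) v
  exact le_of_mul_le_mul_right h2 (norm_pos_iff.2 hv.2)

/-- The powers of `Ψ` are locally uniformly bounded by a geometric sequence. -/
theorem exists_summable_norm_pow_le (hΨ : IsRationalPureInner Ψ) {z₀ : ℂ} (hz : z₀ ∈ disc) :
    ∃ U, IsOpen U ∧ z₀ ∈ U ∧ U ⊆ disc ∧ ∃ u : ℕ → ℝ, Summable u ∧ ∀ z ∈ U, ∀ n, ‖Ψ z ^ n‖ ≤ u n := by
  obtain ⟨N, hN, h⟩ := exists_norm_pow_lt_one (A := Ψ z₀) fun w hw =>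
    hΨ.norm_eigenvalue_lt_one hz hw
  obtain ⟨q, hq, hq1⟩ := exists_between h
  have hq0 : 0 < q := (norm_nonneg _).trans_lt hq
  have hN' : (0 : ℝ) < N := by exact_mod_cast hN
  -- Chosen so that `s ^ N = q`. The strict bound `‖Ψ z ^ N‖ < q` is an open condition on `z`, so a
  -- single ratio `s` serves a whole neighbourhood.
  set s : ℝ := q ^ (1 / N : ℝ) with hs
  have hs0 : 0 < s := Real.rpow_pos_of_pos hq0 _
  have hs1 : s < 1 := Real.rpow_lt_one hq0.le hq1 (by positivity)
  have hsN : s ^ N = q := by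
    rw [hs, ← Real.rpow_natCast, ← Real.rpow_mul hq0.le, one_div, inv_mul_cancel₀ hN'.ne',
      Real.rpow_one]
  have hc : ContinuousOn (fun z => ‖Ψ z ^ N‖) disc := (hΨ.holomorphic.continuousOn.pow N).norm
  refine ⟨disc ∩ (fun z => ‖Ψ z ^ N‖) ⁻¹' Set.Iio q, hc.isOpen_inter_preimage isOpen_disc isOpen_Iio,
    ⟨hz, hq⟩, Set.inter_subset_left, fun n => (s ^ N)⁻¹ * s ^ n,
    (summable_geometric_of_lt_one hs0.le hs1).mul_left _, fun z hz' n => ?_⟩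
  exact norm_pow_le_geometric (hΨ.norm_le_one hz'.1) hN hs0 hs1 (by rw [hsN]; exact hz'.2.le) n

theorem summable_norm_pow (hΨ : IsRationalPureInner Ψ) (hz : z ∈ disc) :
    Summable fun n => ‖Ψ z ^ n‖ := by
  obtain ⟨U, -, hzU, -, u, hu, h⟩ := hΨ.exists_summable_norm_pow_le hz
  exact Summable.of_nonneg_of_le (fun _ => norm_nonneg _) (h z hzU) hu

end IsRationalPureInner

/-- von Neumann's inequality for the single matrix `Ψ z` and the slice `w ↦ f (z, w)`. -/
theorem norm_compΔ_le (hΨ : IsRationalPureInner Ψ) (hf : f ∈ HInf) {C : ℝ}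
    (hC : ∀ p ∈ bidisc, ‖f p‖ ≤ C) (hz : z ∈ disc) :
    ‖compΔ f Ψ z‖ ≤ C ∧ ∀ n, ‖coeff f n z‖ ≤ C :=
  norm_tsum_smul_pow_le (hΨ.norm_le_one hz) (hΨ.summable_norm_pow hz) (a := fun n => coeff f n z)
    (fun _ hw => HInf.hasSum_coeff hf hz hw) fun w hw => hC (z, w) ⟨hz, hw⟩

theorem summable_norm_coeff_smul (hΨ : IsRationalPureInner Ψ) (hf : f ∈ HInf) (hz : z ∈ disc) :
    Summable fun n => ‖coeff f n z • Ψ z ^ n‖ := by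
  obtain ⟨C, hC⟩ := hf.2
  refine Summable.of_nonneg_of_le (fun _ => norm_nonneg _) (fun n => ?_)
    ((hΨ.summable_norm_pow hz).mul_left C)
  rw [norm_smul]
  gcongr
  exact (norm_compΔ_le hΨ hf hC hz).2 n

theorem hasSum_compΔ (hΨ : IsRationalPureInner Ψ) (hf : f ∈ HInf) (hz : z ∈ disc) :
    HasSum (fun n => coeff f n z • Ψ z ^ n) (compΔ f Ψ z) :=
  (summable_norm_coeff_smul hΨ hf hz).of_norm.hasSum

/-- The series converges locally uniformly: the coefficients are bounded by `C` and the powers of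
`Ψ` by a summable sequence near each point. -/
theorem differentiableOn_compΔ (hΨ : IsRationalPureInner Ψ) (hf : f ∈ HInf) :
    DifferentiableOn ℂ (compΔ f Ψ) disc := by
  intro z hz
  obtain ⟨C, hC⟩ := hf.2
  obtain ⟨U, hU, hzU, hUd, u, hu, h⟩ := hΨ.exists_summable_norm_pow_le hz
  have hd : DifferentiableOn ℂ (fun z => ∑' n, coeff f n z • Ψ z ^ n) U := by
    refine differentiableOn_tsum_of_summable_norm (u := fun n => C * u n) (hu.mul_left C)
      (fun n => ?_) hU fun n w hw => ?_
    · exact ((HInf.differentiableOn_coeff hf n).mono hUd).smul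
        ((hΨ.holomorphic.mono hUd).pow n)
    · rw [norm_smul]
      have h1 := (norm_compΔ_le hΨ hf hC (hUd hw)).2 n
      exact mul_le_mul h1 (h w hw n) (norm_nonneg _) ((norm_nonneg _).trans h1)
  exact (hd.differentiableAt (hU.mem_nhds hzU)).differentiableWithinAt

theorem isMultOp_modelCalc (hΨ : IsRationalPureInner Ψ) (hf : f ∈ HInf) :
    IsMultOp (compΔ f Ψ) (modelCalc Ψ f) := by
  obtain ⟨C, hC⟩ := hf.2
  exact isMultOp_multOp (differentiableOn_compΔ hΨ hf) fun z hz => (norm_compΔ_le hΨ hf hC hz).1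

theorem compΔ_congr (h : ∀ p ∈ bidisc, f p = g p) (hz : z ∈ disc) :
    compΔ f Ψ z = compΔ g Ψ z :=
  tsum_congr fun n => congrArg (· • Ψ z ^ n) (coeff_congr h hz n)

theorem compΔ_add (hΨ : IsRationalPureInner Ψ) (hf : f ∈ HInf) (hg : g ∈ HInf) (hz : z ∈ disc) :
    compΔ (fun p => f p + g p) Ψ z = compΔ f Ψ z + compΔ g Ψ z := by
  refine (hasSum_compΔ hΨ (HInf.add hf hg) hz).unique ?_
  have h : ∀ n, coeff (fun p => f p + g p) n z • Ψ z ^ n =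
      coeff f n z • Ψ z ^ n + coeff g n z • Ψ z ^ n := fun n => by
    rw [coeff_add hf hg hz]
    exact add_smul (coeff f n z) (coeff g n z) (Ψ z ^ n)
  simp only [h]
  exact (hasSum_compΔ hΨ hf hz).add (hasSum_compΔ hΨ hg hz)

theorem compΔ_mul (hΨ : IsRationalPureInner Ψ) (hf : f ∈ HInf) (hg : g ∈ HInf) (hz : z ∈ disc) :
    compΔ (fun p => f p * g p) Ψ z = compΔ f Ψ z * compΔ g Ψ z := by
  rw [← (hasSum_compΔ hΨ hf hz).tsum_eq, ← (hasSum_compΔ hΨ hg hz).tsum_eq,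
    tsum_mul_tsum_eq_tsum_sum_antidiagonal_of_summable_norm
      (summable_norm_coeff_smul hΨ hf hz) (summable_norm_coeff_smul hΨ hg hz),
    ← (hasSum_compΔ hΨ (HInf.mul hf hg) hz).tsum_eq]
  refine tsum_congr fun n => ?_
  rw [coeff_mul hf hg hz]
  refine (Finset.sum_smul (x := Ψ z ^ n)).trans ?_
  refine Finset.sum_congr rfl fun kl hkl => ?_
  rw [← Finset.HasAntidiagonal.mem_antidiagonal.1 hkl, smul_mul_smul_comm, pow_add]

/-- If `f(z, ·)` is a polynomial, `f(z, Ψ(z))` is the value of this polynomial at `Ψ(z)`. -/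
theorem compΔ_eq_aeval (hf : f ∈ HInf) (hz : z ∈ disc) {P : Polynomial ℂ}
    (hP : ∀ w ∈ disc, f (z, w) = P.eval w) :
    compΔ f Ψ z = Polynomial.aeval (Ψ z) P := by
  have hc : ∀ n, coeff f n z = P.coeff n := coeff_eq_of_hasSum hf hz fun w hw => by
    rw [hP w hw, Polynomial.eval_eq_sum_range]
    simp only [mul_comm (P.coeff _)]
    refine hasSum_sum_of_ne_finset_zero fun n hn => ?_
    rw [Polynomial.coeff_eq_zero_of_natDegree_lt (by simpa using hn), mul_zero]
  rw [Polynomial.aeval_eq_sum_range]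
  change ∑' n, coeff f n z • Ψ z ^ n = _
  simp only [hc]
  refine tsum_eq_sum fun n hn => ?_
  rw [Polynomial.coeff_eq_zero_of_natDegree_lt (by simpa using hn)]
  exact zero_smul ℂ (Ψ z ^ n)

theorem compΔ_const (c : ℂ) (hz : z ∈ disc) :
    compΔ (fun _ => c) Ψ z = c • ContinuousLinearMap.id ℂ (Cd d) := by
  rw [compΔ_eq_aeval (HInf.const c) hz (P := Polynomial.C c) (by simp), Polynomial.aeval_C,
    Algebra.algebraMap_eq_smul_one]
  rfl

theorem compΔ_fst (hz : z ∈ disc) :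
    compΔ (fun p => p.1) Ψ z = z • ContinuousLinearMap.id ℂ (Cd d) := by
  rw [compΔ_eq_aeval HInf.fst hz (P := Polynomial.C z) (by simp), Polynomial.aeval_C,
    Algebra.algebraMap_eq_smul_one]
  rfl

theorem compΔ_snd (hz : z ∈ disc) : compΔ (fun p => p.2) Ψ z = Ψ z := by
  rw [compΔ_eq_aeval HInf.snd hz (P := Polynomial.X) (by simp), Polynomial.aeval_X]

/-- A left eigenvector of `Ψ(z)` for the eigenvalue `w` is one of `f(z, Ψ(z))` for `f(z, w)`. -/
theorem inner_compΔ (hΨ : IsRationalPureInner Ψ) (hf : f ∈ HInf) (hz : z ∈ disc) {w : ℂ}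
    (hw : w ∈ disc) {v : Cd d} (hv : ∀ x, ⟪v, Ψ z x⟫_ℂ = w * ⟪v, x⟫_ℂ) (x : Cd d) :
    ⟪v, compΔ f Ψ z x⟫_ℂ = f (z, w) * ⟪v, x⟫_ℂ := by
  have hpow : ∀ n, ⟪v, (Ψ z ^ n) x⟫_ℂ = w ^ n * ⟪v, x⟫_ℂ := by
    intro n
    induction n with
    | zero => simp
    | succ n ih => rw [pow_succ', mul_apply_eq_comp, hv, ih, pow_succ', mul_assoc]
  have h1 := (innerSL ℂ v).hasSum
    ((ContinuousLinearMap.apply ℂ _ x).hasSum (hasSum_compΔ hΨ hf hz))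
  simp only [apply_apply, map_smul, innerSL_apply_apply, hpow] at h1
  have h2 : ∀ n, coeff f n z • (w ^ n * ⟪v, x⟫_ℂ) = w ^ n * coeff f n z * ⟪v, x⟫_ℂ := fun n => by
    rw [smul_eq_mul]; ring
  simp only [h2] at h1
  exact h1.unique ((HInf.hasSum_coeff hf hz hw).mul_right _)

theorem modelCalc_eq_of_forall {M : Hardy (Cd d) →L[ℂ] Hardy (Cd d)} (hΨ : IsRationalPureInner Ψ)
    (hf : f ∈ HInf) {Φ : ℂ → Cd d →L[ℂ] Cd d} (hM : IsMultOp Φ M)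
    (h : ∀ z ∈ disc, compΔ f Ψ z = Φ z) : modelCalc Ψ f = M := by
  ext1 x
  exact Hardy.eval_injective fun z hz => by
    rw [isMultOp_modelCalc hΨ hf x z hz, hM x z hz, h z hz]

theorem modelCalc_add (hΨ : IsRationalPureInner Ψ) (hf : f ∈ HInf) (hg : g ∈ HInf) :
    modelCalc Ψ (fun p => f p + g p) = modelCalc Ψ f + modelCalc Ψ g := by
  refine modelCalc_eq_of_forall hΨ (HInf.add hf hg) (Φ := fun z => compΔ f Ψ z + compΔ g Ψ z)
    (fun x z hz => ?_) fun z hz => compΔ_add hΨ hf hg hz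
  rw [← Hardy.evalL_apply hz, add_apply, map_add, add_apply, Hardy.evalL_apply, Hardy.evalL_apply,
    isMultOp_modelCalc hΨ hf x z hz, isMultOp_modelCalc hΨ hg x z hz]

theorem modelCalc_mul (hΨ : IsRationalPureInner Ψ) (hf : f ∈ HInf) (hg : g ∈ HInf) :
    modelCalc Ψ (fun p => f p * g p) = modelCalc Ψ f * modelCalc Ψ g := by
  refine modelCalc_eq_of_forall hΨ (HInf.mul hf hg) (Φ := fun z => compΔ f Ψ z * compΔ g Ψ z)
    (fun x z hz => ?_) fun z hz => compΔ_mul hΨ hf hg hz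
  rw [mul_apply_eq_comp, mul_apply_eq_comp, isMultOp_modelCalc hΨ hf _ z hz,
    isMultOp_modelCalc hΨ hg x z hz]

theorem modelCalc_const (hΨ : IsRationalPureInner Ψ) (c : ℂ) :
    modelCalc Ψ (fun _ => c) = c • ContinuousLinearMap.id ℂ (Hardy (Cd d)) := by
  refine modelCalc_eq_of_forall hΨ (HInf.const c)
    (Φ := fun _ => c • ContinuousLinearMap.id ℂ (Cd d))
    (fun x z hz => ?_) fun z hz => compΔ_const c hz
  rw [← Hardy.evalL_apply hz, smul_apply, map_smul]
  rfl

theorem modelCalc_fst (hΨ : IsRationalPureInner Ψ) :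
    modelCalc Ψ (fun p => p.1) = shift :=
  modelCalc_eq_of_forall hΨ HInf.fst isMultOp_shift fun _ hz => compΔ_fst hz

theorem modelCalc_snd (hΨ : IsRationalPureInner Ψ) :
    modelCalc Ψ (fun p => p.2) = multOp Ψ :=
  modelCalc_eq_of_forall hΨ HInf.snd hΨ.isMultOp fun _ hz => compΔ_snd hz

theorem modelCalc_congr (hΨ : IsRationalPureInner Ψ) (hf : f ∈ HInf) (hg : g ∈ HInf)
    (h : ∀ p ∈ bidisc, f p = g p) : modelCalc Ψ f = modelCalc Ψ g :=
  modelCalc_eq_of_forall hΨ hf (isMultOp_modelCalc hΨ hg) fun _ hz => compΔ_congr h hz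

theorem modelCalc_comm (hΨ : IsRationalPureInner Ψ) (hf : f ∈ HInf) (hg : g ∈ HInf) :
    modelCalc Ψ f * modelCalc Ψ g = modelCalc Ψ g * modelCalc Ψ f := by
  rw [← modelCalc_mul hΨ hf hg, ← modelCalc_mul hΨ hg hf]
  simp only [mul_comm]

end Calculus

/-! ### Bounded rational functions on the disc -/

section RationalFunctions

theorem closure_disc : closure disc = Metric.closedBall 0 1 := closure_ball 0 one_ne_zero

/-- A bounded rational function in the disc is a quotient of polynomials whose denominator has no
zero in the closed disc. -/
theorem exists_eval_ne_zero_of_bounded {p q : Polynomial ℂ} (hq : ∀ z ∈ disc, q.eval z ≠ 0) {C : ℝ}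
    (hC : ∀ z ∈ disc, ‖p.eval z / q.eval z‖ ≤ C) :
    ∃ p' q' : Polynomial ℂ, (∀ z ∈ closure disc, q'.eval z ≠ 0) ∧
      ∀ z ∈ disc, p.eval z / q.eval z = p'.eval z / q'.eval z := by
  have hq0 : q ≠ 0 := by
    rintro rfl
    exact hq 0 (by simp [disc]) (by simp)
  set g := EuclideanDomain.gcd p q
  obtain ⟨p', hp'⟩ : g ∣ p := EuclideanDomain.gcd_dvd_left p q
  obtain ⟨q', hq'⟩ : g ∣ q := EuclideanDomain.gcd_dvd_right p q
  have hg0 : g ≠ 0 := by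
    intro h
    rw [h, zero_mul] at hq'
    exact hq0 hq'
  have hcop : IsCoprime p' q' := by
    obtain ⟨a, b, hab⟩ : ∃ a b, a * p + b * q = g :=
      ⟨EuclideanDomain.gcdA p q, EuclideanDomain.gcdB p q, by
        rw [mul_comm _ p, mul_comm _ q, ← EuclideanDomain.gcd_eq_gcd_ab]⟩
    refine ⟨a, b, mul_left_cancel₀ hg0 ?_⟩
    rw [mul_one]
    conv_rhs => rw [← hab, hp', hq']
    ring
  have hfac : ∀ z ∈ disc, g.eval z ≠ 0 ∧ q'.eval z ≠ 0 := fun z hz => by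
    have := hq z hz
    rw [hq', Polynomial.eval_mul] at this
    exact mul_ne_zero_iff.1 this
  have heq : ∀ z ∈ disc, p.eval z / q.eval z = p'.eval z / q'.eval z := fun z hz => by
    rw [hp', hq', Polynomial.eval_mul, Polynomial.eval_mul, mul_div_mul_left _ _ (hfac z hz).1]
  refine ⟨p', q', fun z hz h0 => ?_, heq⟩
  -- The inequality `|p'| ≤ C |q'|` passes to the closed disc, so a zero of `q'` there would also be
  -- a zero of `p'`, contradicting coprimality.
  have hcl : closure disc ⊆ {z | ‖p'.eval z‖ ≤ C * ‖q'.eval z‖} := by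
    refine closure_minimal (fun z hz => ?_) (isClosed_le (by fun_prop) (by fun_prop))
    have := hC z hz
    rwa [heq z hz, norm_div, div_le_iff₀ (norm_pos_iff.2 (hfac z hz).2)] at this
  have h1 : p'.eval z = 0 := by
    have h : ‖p'.eval z‖ ≤ C * ‖q'.eval z‖ := hcl hz
    rw [h0, norm_zero, mul_zero] at h
    exact norm_le_zero_iff.1 h
  obtain ⟨a, b, hab⟩ := hcop
  have := congrArg (Polynomial.eval z) hab
  simp [h0, h1] at this

/-- Division of a bounded rational function at a point of the closed disc. -/
theorem exists_eq_add_mul_of_bounded_rational {p q : Polynomial ℂ} (hq : ∀ z ∈ disc, q.eval z ≠ 0)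
    {C : ℝ} (hC : ∀ z ∈ disc, ‖p.eval z / q.eval z‖ ≤ C) {l : ℂ} (hl : ‖l‖ ≤ 1) :
    ∃ (c : ℂ) (k : ℂ → ℂ) (B : ℝ), DifferentiableOn ℂ k disc ∧ (∀ z ∈ disc, ‖k z‖ ≤ B) ∧
      ∀ z ∈ disc, p.eval z / q.eval z = c + (z - l) * k z := by
  obtain ⟨p', q', hq', heq⟩ := exists_eval_ne_zero_of_bounded hq hC
  have hl' : l ∈ closure disc := by rw [closure_disc]; simpa using hl
  -- This is the numerator of `p'/q' - p'(l)/q'(l)` over the common denominator `q' · q'(l)`.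
  obtain ⟨r, hr⟩ : (Polynomial.X - Polynomial.C l) ∣
      (p' * Polynomial.C (q'.eval l) - q' * Polynomial.C (p'.eval l)) := by
    rw [Polynomial.dvd_iff_isRoot]
    simp [Polynomial.IsRoot, mul_comm]
  have hcomp : IsCompact (closure disc) := by
    rw [closure_disc]; exact isCompact_closedBall 0 1
  have hne : ∀ z ∈ closure disc, q'.eval z * q'.eval l ≠ 0 := fun z hz =>
    mul_ne_zero (hq' z hz) (hq' l hl')
  obtain ⟨B, hB⟩ := hcomp.exists_bound_of_continuousOn
    (f := fun z => r.eval z / (q'.eval z * q'.eval l))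
    (ContinuousOn.div (by fun_prop) (by fun_prop) hne)
  refine ⟨p'.eval l / q'.eval l, fun z => r.eval z / (q'.eval z * q'.eval l), B, ?_,
    fun z hz => hB z (subset_closure hz), fun z hz => ?_⟩
  · exact DifferentiableOn.div (by fun_prop) (by fun_prop) fun z hz => hne z (subset_closure hz)
  · have h1 := congrArg (Polynomial.eval z) hr
    simp only [Polynomial.eval_sub, Polynomial.eval_mul, Polynomial.eval_C,
      Polynomial.eval_X] at h1
    have h2 := hq' z (subset_closure hz)
    have h3 := hq' l hl'
    rw [heq z hz]
    field_simp
    linear_combination h1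

end RationalFunctions

/-! ### The characteristic function and its division at points of the closed bidisc -/

section Gleason

/-- The bounded holomorphic functions on the bidisc that differ from a constant by an element of
`(z - λ) H^∞(𝔻²) + (w - μ) H^∞(𝔻²)`. -/
def gleason (a : ℂ × ℂ) : Subalgebra ℂ (ℂ × ℂ → ℂ) where
  carrier := {h | h ∈ HInf ∧ ∃ c : ℂ, ∃ f ∈ HInf, ∃ g ∈ HInf, ∀ p ∈ bidisc,
    h p = c + (p.1 - a.1) * f p + (p.2 - a.2) * g p}
  mul_mem' := by
    rintro h k ⟨hh, c, f, hf, g, hg, e⟩ ⟨hk, c', f', hf', g', hg', e'⟩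
    refine ⟨HInf.mul hh hk, c * c', _, HInf.add (HInf.mul (HInf.const c) hf') (HInf.mul hf hk), _,
      HInf.add (HInf.mul (HInf.const c) hg') (HInf.mul hg hk), fun p hp => ?_⟩
    rw [Pi.mul_apply, e p hp, e' p hp]; ring
  add_mem' := by
    rintro h k ⟨hh, c, f, hf, g, hg, e⟩ ⟨hk, c', f', hf', g', hg', e'⟩
    refine ⟨HInf.add hh hk, c + c', _, HInf.add hf hf', _, HInf.add hg hg', fun p hp => ?_⟩
    rw [Pi.add_apply, e p hp, e' p hp]; ring
  algebraMap_mem' := fun c => ⟨HInf.const c, c, _, HInf.const 0, _, HInf.const 0, fun p _ => by simp⟩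

theorem snd_mem_gleason (a : ℂ × ℂ) : (fun p : ℂ × ℂ => p.2) ∈ gleason a :=
  ⟨HInf.snd, a.2, _, HInf.const 0, _, HInf.const 1, fun p _ => by ring⟩

theorem HInf.comp_fst {k : ℂ → ℂ} (hk : DifferentiableOn ℂ k disc) {B : ℝ}
    (hB : ∀ z ∈ disc, ‖k z‖ ≤ B) : (fun p : ℂ × ℂ => k p.1) ∈ HInf :=
  ⟨hk.comp differentiableOn_fst fun _ hp => hp.1, B, fun p hp => hB p.1 hp.1⟩

variable {d : ℕ} {Ψ : ℂ → Cd d →L[ℂ] Cd d}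

/-- Rationality is essential here: a bounded rational function has no pole on the closed disc, so it
can be divided at boundary points too, where a general bounded holomorphic function cannot. -/
theorem entry_mem_gleason (hΨ : IsRationalPureInner Ψ) {a : ℂ × ℂ} (ha : ‖a.1‖ ≤ 1) (i j : Fin d) :
    (fun p : ℂ × ℂ => (Ψ p.1 (EuclideanSpace.single j 1)) i) ∈ gleason a := by
  have hbd : ∀ z ∈ disc, ‖(Ψ z (EuclideanSpace.single j 1)) i‖ ≤ 1 := fun z hz => by
    refine (PiLp.norm_apply_le _ i).trans (((Ψ z).le_of_opNorm_le (hΨ.norm_le_one hz) _).trans ?_)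
    simp
  have hdiff : DifferentiableOn ℂ (fun z => (Ψ z (EuclideanSpace.single j 1)) i) disc := by
    have h1 := hΨ.holomorphic.clm_apply
      (differentiableOn_const (c := (EuclideanSpace.single j 1 : Cd d)))
    exact (EuclideanSpace.proj i : Cd d →L[ℂ] ℂ).differentiable.comp_differentiableOn h1
  obtain ⟨p, q, hpq⟩ := hΨ.rational i j
  obtain ⟨c, k, B, hk, hB, e⟩ := exists_eq_add_mul_of_bounded_rational
    (fun z hz => (hpq z hz).1) (fun z hz => (hpq z hz).2 ▸ hbd z hz) ha
  refine ⟨HInf.comp_fst hdiff hbd, c, _, HInf.comp_fst hk hB, _, HInf.const 0, fun x hx => ?_⟩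
  simp only [(hpq _ hx.1).2, e _ hx.1, mul_zero, add_zero]

/-- The characteristic function `det(w I - Ψ(z))`. -/
def charFun (Ψ : ℂ → Cd d →L[ℂ] Cd d) (p : ℂ × ℂ) : ℂ :=
  (Ψ p.1 : Cd d →ₗ[ℂ] Cd d).charpoly.eval p.2

theorem charFun_eq_det (p : ℂ × ℂ) : charFun Ψ p = Matrix.det (Matrix.of fun i j : Fin d =>
    (if i = j then p.2 else 0) - (Ψ p.1 (EuclideanSpace.single j 1)) i) := by
  rw [charFun, LinearMap.eval_charpoly,
    ← LinearMap.det_toMatrix (EuclideanSpace.basisFun (Fin d) ℂ).toBasis]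
  congr 1
  ext i j
  simp [LinearMap.toMatrix_apply, Algebra.algebraMap_eq_smul_one]

/-- A determinant is a polynomial in the entries, and `gleason a` is an algebra containing `w` and
the entries of `Ψ`. -/
theorem charFun_mem_gleason (hΨ : IsRationalPureInner Ψ) {a : ℂ × ℂ} (ha : ‖a.1‖ ≤ 1) :
    charFun Ψ ∈ gleason a := by
  set N : Matrix (Fin d) (Fin d) (ℂ × ℂ → ℂ) := Matrix.of fun i j =>
    (if i = j then (fun p : ℂ × ℂ => p.2) else 0) -
      fun p => (Ψ p.1 (EuclideanSpace.single j 1)) i with hN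
  have h1 : charFun Ψ = N.det := by
    ext p
    have := (Pi.evalRingHom (fun _ : ℂ × ℂ => ℂ) p).map_det N
    simp only [Pi.evalRingHom_apply] at this
    rw [this, charFun_eq_det]
    congr 1
    ext i j
    simp only [hN, RingHom.mapMatrix_apply, Matrix.map_apply, Matrix.of_apply,
      Pi.evalRingHom_apply, Pi.sub_apply]
    split_ifs <;> rfl
  have hmem : ∀ i j, N i j ∈ gleason a := fun i j => by
    refine sub_mem ?_ (entry_mem_gleason hΨ ha i j)
    split_ifs
    · exact snd_mem_gleason a
    · exact zero_mem _
  rw [h1, Matrix.det_apply']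
  exact sum_mem fun σ _ => mul_mem (intCast_mem _ _) (prod_mem fun i _ => hmem _ _)

theorem charFun_mem_HInf (hΨ : IsRationalPureInner Ψ) : charFun Ψ ∈ HInf :=
  (charFun_mem_gleason hΨ (a := 0) (by simp)).1

theorem modelCalc_eq_zero (hΨ : IsRationalPureInner Ψ) {f : ℂ × ℂ → ℂ} (hf : f ∈ HInf) :
    modelCalc Ψ f = 0 ↔ ∀ z ∈ disc, compΔ f Ψ z = 0 := by
  constructor
  · intro h z hz
    ext1 x
    have h1 := isMultOp_modelCalc hΨ hf (lp.single 2 0 x) z hz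
    have h2 : Hardy.eval (lp.single 2 0 x) z = x := by
      rw [Hardy.eval, tsum_eq_single 0 (fun n hn => by simp [lp.single_apply, hn])]
      simp
    rw [h, h2, zero_apply, ← Hardy.evalL_apply hz, map_zero] at h1
    rw [← h1, zero_apply]
  · intro h
    refine modelCalc_eq_of_forall hΨ hf (Φ := fun _ => 0) (fun x z hz => ?_) h
    rw [zero_apply, zero_apply, ← Hardy.evalL_apply hz, map_zero]

/-- This is the Cayley–Hamilton theorem at each point `z`. -/
theorem charFun_mem_modelAnn (hΨ : IsRationalPureInner Ψ) : charFun Ψ ∈ modelAnn Ψ := by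
  refine ⟨charFun_mem_HInf hΨ, (modelCalc_eq_zero hΨ (charFun_mem_HInf hΨ)).2 fun z hz => ?_⟩
  rw [compΔ_eq_aeval (P := (Ψ z : Cd d →ₗ[ℂ] Cd d).charpoly) (charFun_mem_HInf hΨ) hz
    fun w _ => rfl]
  have h := Polynomial.aeval_algHom_apply (Module.End.toContinuousLinearMap (Cd d)).toAlgHom
    (Ψ z : Cd d →ₗ[ℂ] Cd d) (Ψ z : Cd d →ₗ[ℂ] Cd d).charpoly
  rw [LinearMap.aeval_self_charpoly, map_zero] at h
  exact h

end Gleason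

/-! ### The closure of the variety as the support of the model annihilator -/

section Variety

variable {d : ℕ} {Ψ : ℂ → Cd d →L[ℂ] Cd d}

theorem mem_variety_iff {p : ℂ × ℂ} : p ∈ variety Ψ ↔ p ∈ bidisc ∧ charFun Ψ p = 0 := by
  refine and_congr_right fun _ => ?_
  have : (Ψ p.1 - p.2 • ContinuousLinearMap.id ℂ (Cd d)).det =
      (-1) ^ d * charFun Ψ p := by
    rw [charFun, LinearMap.eval_charpoly, ContinuousLinearMap.det]
    have h : ((Ψ p.1 - p.2 • ContinuousLinearMap.id ℂ (Cd d) : Cd d →L[ℂ] Cd d) :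
        Cd d →ₗ[ℂ] Cd d) = (-1 : ℂ) • (algebraMap ℂ (Module.End ℂ (Cd d)) p.2 -
          (Ψ p.1 : Cd d →ₗ[ℂ] Cd d)) := by
      ext1 x
      simp [Algebra.algebraMap_eq_smul_one]
    rw [h, LinearMap.det_smul]
    simp
  rw [this, mul_eq_zero, or_iff_right (pow_ne_zero _ (by norm_num))]

/-- No condition on `p.2` is needed: a zero is an eigenvalue of `Ψ p.1`, hence already in the open
disc. -/
theorem charFun_eq_zero_iff (hΨ : IsRationalPureInner Ψ) {p : ℂ × ℂ} (hz : p.1 ∈ disc) :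
    charFun Ψ p = 0 ↔ p ∈ variety Ψ := by
  refine ⟨fun h => mem_variety_iff.2 ⟨⟨hz, ?_⟩, h⟩, fun h => (mem_variety_iff.1 h).2⟩
  refine mem_disc_iff.2 (hΨ.norm_eigenvalue_lt_one hz ?_)
  exact (Module.End.hasEigenvalue_iff_isRoot_charpoly _ _).2 h

/-- A point `(z, w)` of the variety gives a left eigenvector of `Ψ(z)`. -/
theorem exists_left_eigenvector {p : ℂ × ℂ} (hp : p ∈ variety Ψ) :
    ∃ v : Cd d, v ≠ 0 ∧ ∀ x, ⟪v, Ψ p.1 x⟫_ℂ = p.2 * ⟪v, x⟫_ℂ := by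
  -- `Ψ(z) - w` is not surjective, and any nonzero vector orthogonal to its range is a left
  -- eigenvector.
  have hlt := LinearMap.range_lt_top_of_det_eq_zero hp.2
  obtain ⟨v, hv, hv0⟩ := Submodule.exists_mem_ne_zero_of_ne_bot
    (fun h => hlt.ne ((Submodule.orthogonal_eq_bot_iff).1 h))
  refine ⟨v, hv0, fun x => ?_⟩
  have := (Submodule.mem_orthogonal' _ _).1 hv _ (LinearMap.mem_range_self _ x)
  rw [coe_coe, sub_apply, smul_apply, inner_sub_right, inner_smul_right] at this
  exact sub_eq_zero.1 this

theorem eq_zero_of_mem_modelAnn (hΨ : IsRationalPureInner Ψ) {f : ℂ × ℂ → ℂ} (hf : f ∈ modelAnn Ψ)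
    {p : ℂ × ℂ} (hp : p ∈ variety Ψ) : f p = 0 := by
  obtain ⟨v, hv0, hv⟩ := exists_left_eigenvector hp
  have h1 := inner_compΔ hΨ hf.1 hp.1.1 hp.1.2 hv v
  rw [(modelCalc_eq_zero hΨ hf.1).1 hf.2 _ hp.1.1, zero_apply, inner_zero_right] at h1
  exact (mul_eq_zero.1 h1.symm).resolve_right (inner_self_ne_zero.2 hv0)

/-- On the variety `φ` vanishes, so the remaining terms would sum to `1` there, while boundedness of
`f` and `g` makes them small near `a`. -/
theorem closure_variety_subset (hΨ : IsRationalPureInner Ψ) :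
    closure (variety Ψ) ⊆ supp (modelAnn Ψ) := by
  rintro a ha ⟨φ, hφ, f, hf, g, hg, e⟩
  obtain ⟨C, hC⟩ := hf.2
  obtain ⟨D, hD⟩ := hg.2
  have hlim : Tendsto (fun p : ℂ × ℂ => ‖p.1 - a.1‖ * C + ‖p.2 - a.2‖ * D) (𝓝 a) (𝓝 0) := by
    have hc : Continuous fun p : ℂ × ℂ => ‖p.1 - a.1‖ * C + ‖p.2 - a.2‖ * D := by fun_prop
    simpa using hc.tendsto a
  obtain ⟨p, hp, hlt⟩ := ((mem_closure_iff_frequently.1 ha).and_eventually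
    (hlim.eventually (gt_mem_nhds one_pos))).exists
  have h1 := e p hp.1
  rw [eq_zero_of_mem_modelAnn hΨ hφ hp, zero_add] at h1
  refine absurd hlt (not_lt.2 ?_)
  calc (1 : ℝ) = ‖(p.1 - a.1) * f p + (p.2 - a.2) * g p‖ := by rw [← h1]; simp
    _ ≤ ‖p.1 - a.1‖ * ‖f p‖ + ‖p.2 - a.2‖ * ‖g p‖ := by
      refine (norm_add_le _ _).trans ?_
      rw [norm_mul, norm_mul]
    _ ≤ _ := by
      gcongr
      · exact hC p hp.1
      · exact hD p hp.1

theorem pow_card_le_norm_prod_map_sub {s : Multiset ℂ} {δ : ℝ} (hδ : 0 ≤ δ) {x : ℂ}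
    (h : ∀ r ∈ s, δ ≤ ‖x - r‖) : δ ^ s.card ≤ ‖(s.map (x - ·)).prod‖ := by
  induction s using Multiset.induction with
  | empty => simp
  | cons r s ih =>
    rw [Multiset.card_cons, pow_succ', Multiset.map_cons, Multiset.prod_cons, norm_mul]
    exact mul_le_mul (h r (Multiset.mem_cons_self r s))
      (ih fun r' hr' => h r' (Multiset.mem_cons_of_mem hr')) (by positivity) (norm_nonneg _)

/-- The monic polynomial `charFun Ψ (p.1, ·)` of degree `d` splits over `ℂ`, and each linear factor
contributes at least `δ`. -/
theorem pow_le_norm_charFun {p : ℂ × ℂ} {δ : ℝ} (hδ : 0 ≤ δ)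
    (h : ∀ w, charFun Ψ (p.1, w) = 0 → δ ≤ ‖p.2 - w‖) : δ ^ d ≤ ‖charFun Ψ p‖ := by
  set P := (Ψ p.1 : Cd d →ₗ[ℂ] Cd d).charpoly with hP
  have hs : P.Splits := IsAlgClosed.splits P
  have hm : P.Monic := LinearMap.charpoly_monic _
  have hdeg : P.roots.card = d := by
    rw [← hs.natDegree_eq_card_roots, hP, LinearMap.charpoly_natDegree]; simp
  have := pow_card_le_norm_prod_map_sub hδ (s := P.roots) (x := p.2) fun r hr =>
    h r ((Polynomial.mem_roots hm.ne_zero).1 hr)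
  rwa [hdeg, ← hs.eval_eq_prod_roots_of_monic hm] at this

theorem HInf.sub_const_inv {l : ℂ} (hl : 1 < ‖l‖) : (fun p : ℂ × ℂ => (p.1 - l)⁻¹) ∈ HInf := by
  have hlow : ∀ z ∈ disc, ‖l‖ - 1 ≤ ‖z - l‖ := fun z hz => by
    have h1 := mem_disc_iff.1 hz
    have h2 := norm_sub_norm_le l z
    rw [norm_sub_rev] at h2
    linarith
  refine HInf.comp_fst (k := fun z => (z - l)⁻¹) (B := (‖l‖ - 1)⁻¹) (DifferentiableOn.inv (by fun_prop) fun z hz => ?_)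
    fun z hz => ?_
  · exact norm_pos_iff.1 ((sub_pos.2 hl).trans_le (hlow z hz))
  · rw [norm_inv]
    exact inv_anti₀ (sub_pos.2 hl) (hlow z hz)

theorem zero_mem_modelAnn (hΨ : IsRationalPureInner Ψ) : (fun _ => (0 : ℂ)) ∈ modelAnn Ψ :=
  ⟨HInf.const 0, by rw [modelCalc_const hΨ, zero_smul]⟩

theorem const_mul_mem_modelAnn (hΨ : IsRationalPureInner Ψ) {f : ℂ × ℂ → ℂ} (hf : f ∈ modelAnn Ψ)
    (c : ℂ) : (fun p => c * f p) ∈ modelAnn Ψ :=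
  ⟨HInf.mul (HInf.const c) hf.1, by rw [modelCalc_mul hΨ (HInf.const c) hf.1, hf.2, mul_zero]⟩

theorem supp_modelAnn_subset (hΨ : IsRationalPureInner Ψ) :
    supp (modelAnn Ψ) ⊆ closure (variety Ψ) := by
  intro a ha
  by_contra hcl
  refine ha ?_
  have hne : ∀ {l z : ℂ}, 1 < ‖l‖ → z ∈ disc → z - l ≠ 0 := fun hl hz h => by
    have := mem_disc_iff.1 hz
    rw [sub_eq_zero.1 h] at this
    linarith
  by_cases h1 : 1 < ‖a.1‖
  · refine ⟨_, zero_mem_modelAnn hΨ, _, HInf.sub_const_inv h1, _, HInf.const 0, fun p hp => ?_⟩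
    rw [mul_inv_cancel₀ (hne h1 hp.1)]; ring
  by_cases h2 : 1 < ‖a.2‖
  · refine ⟨_, zero_mem_modelAnn hΨ, _, HInf.const 0, _, HInf.comp_swap (HInf.sub_const_inv h2),
      fun p hp => ?_⟩
    rw [Prod.fst_swap, mul_inv_cancel₀ (hne h2 hp.2)]; ring
  push Not at h1 h2
  obtain ⟨hχ, c, f, hf, g, hg, e⟩ := charFun_mem_gleason hΨ h1
  suffices hc : c ≠ 0 by
    refine ⟨_, const_mul_mem_modelAnn hΨ (charFun_mem_modelAnn hΨ) c⁻¹,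
      _, HInf.mul (HInf.const (-c⁻¹)) hf, _, HInf.mul (HInf.const (-c⁻¹)) hg, fun p hp => ?_⟩
    rw [e p hp]
    field_simp
    ring
  rintro rfl
  obtain ⟨ε, hε, hball⟩ := Metric.isOpen_iff.1 isClosed_closure.isOpen_compl a hcl
  obtain ⟨C, hC⟩ := hf.2
  obtain ⟨D, hD⟩ := hg.2
  -- The point `a` may lie on the boundary, so it is approached radially. If `c = 0`, then `charFun
  -- Ψ` tends to `0` along this path.
  have hcont : Continuous fun t : ℝ => (t : ℂ) • a := by fun_prop
  have hlim : Tendsto (fun t : ℝ => (t : ℂ) • a) (𝓝[<] 1) (𝓝 a) := by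
    simpa using (hcont.tendsto 1).mono_left nhdsWithin_le_nhds
  have hbi : ∀ᶠ t : ℝ in 𝓝[<] 1, (t : ℂ) • a ∈ bidisc := by
    filter_upwards [Ioo_mem_nhdsLT (zero_lt_one' ℝ)] with t ht
    have : ∀ x : ℂ, ‖x‖ ≤ 1 → (t : ℂ) * x ∈ disc := fun x hx => by
      rw [mem_disc_iff, norm_mul, norm_real, Real.norm_of_nonneg ht.1.le]
      exact mul_lt_one_of_nonneg_of_lt_one_left ht.1.le ht.2 hx
    exact ⟨this _ h1, this _ h2⟩
  have hsmall : Tendsto (fun p : ℂ × ℂ => ‖p.1 - a.1‖ * C + ‖p.2 - a.2‖ * D) (𝓝 a) (𝓝 0) := by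
    have hc : Continuous fun p : ℂ × ℂ => ‖p.1 - a.1‖ * C + ‖p.2 - a.2‖ * D := by fun_prop
    simpa using hc.tendsto a
  have hpos : 0 < (ε / 2) ^ d := by positivity
  obtain ⟨t, ht, hlt, hdist⟩ := (hbi.and (((hsmall.comp hlim).eventually (gt_mem_nhds hpos)).and
    (hlim.eventually (Metric.ball_mem_nhds a (half_pos hε))))).exists
  set p := (t : ℂ) • a with hp
  -- A root `w` within `ε / 2` of `p.2`, with `p` within `ε / 2` of `a`, would give a point of the
  -- variety within `ε` of `a`.
  have hlow : (ε / 2) ^ d ≤ ‖charFun Ψ p‖ := by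
    refine pow_le_norm_charFun (half_pos hε).le fun w hw => ?_
    by_contra! hclose
    have hmem : (p.1, w) ∈ Metric.ball a ε := by
      have h := Metric.mem_ball.1 hdist
      rw [Prod.dist_eq, max_lt_iff] at h
      rw [Metric.mem_ball, Prod.dist_eq, max_lt_iff]
      refine ⟨h.1.trans (half_lt_self hε), (dist_triangle w p.2 a.2).trans_lt ?_⟩
      rw [dist_comm w, dist_eq_norm p.2 w]
      linarith [h.2]
    exact hball hmem (subset_closure ((charFun_eq_zero_iff hΨ (p := (p.1, w)) ht.1).1 hw))
  refine absurd hlow (not_le.2 (lt_of_le_of_lt ?_ hlt))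
  rw [e p ht, zero_add]
  refine (norm_add_le _ _).trans ?_
  rw [norm_mul, norm_mul]
  simp only [Function.comp_apply]
  gcongr
  · exact hC p ht
  · exact hD p ht

end Variety

/-! ### Exactness of the Koszul complex -/

section TaylorSpectrum

/-- A point is not in the Taylor spectrum if `(A - λ) F + (B - μ) G = 1` for operators commuting
with each other and with `A` and `B`. -/
theorem notMem_taylorSpectrum {X : Type*} [NormedAddCommGroup X] [NormedSpace ℂ X]
    {A B F G : X →L[ℂ] X} {a : ℂ × ℂ}
    (hAF : ∀ x, (A - a.1 • .id ℂ X) (F x) = F ((A - a.1 • .id ℂ X) x))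
    (hAG : ∀ x, (A - a.1 • .id ℂ X) (G x) = G ((A - a.1 • .id ℂ X) x))
    (hBF : ∀ x, (B - a.2 • .id ℂ X) (F x) = F ((B - a.2 • .id ℂ X) x))
    (hBG : ∀ x, (B - a.2 • .id ℂ X) (G x) = G ((B - a.2 • .id ℂ X) x))
    (hAB : ∀ x, (A - a.1 • .id ℂ X) ((B - a.2 • .id ℂ X) x) =
      (B - a.2 • .id ℂ X) ((A - a.1 • .id ℂ X) x))
    (h : ∀ x, (A - a.1 • .id ℂ X) (F x) + (B - a.2 • .id ℂ X) (G x) = x) :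
    a ∉ taylorSpectrum A B := by
  simp only [taylorSpectrum, Set.mem_ofPred_eq, not_not]
  set A' := A - a.1 • ContinuousLinearMap.id ℂ X
  set B' := B - a.2 • ContinuousLinearMap.id ℂ X
  refine ⟨fun x y hxy => ?_, fun p => ⟨fun hp => ?_, ?_⟩, fun y => ?_⟩
  · obtain ⟨h1, h2⟩ := Prod.mk.inj hxy
    rw [← h x, ← h y, hAF, hAF, hBG, hBG, h1, h2]
  · have hp' : A' p.2 = B' p.1 := sub_eq_zero.1 hp
    -- `F` and `G` give a contracting homotopy of the Koszul complex; this is its middle component.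
    refine ⟨F p.1 + G p.2, Prod.ext ?_ ?_⟩
    · simp only [koszul₀, map_add]
      rw [hAG, hp', ← hBG, h]
    · simp only [koszul₀, map_add]
      rw [hBF, ← hp', ← hAF, h]
  · rintro ⟨x, rfl⟩
    simp only [koszul₁, koszul₀, hAB, sub_self]
  · refine ⟨(-G y, F y), ?_⟩
    simp only [koszul₁, map_neg, sub_neg_eq_add, h]

end TaylorSpectrum

/-! ### Compression to a co-invariant subspace -/

section Compression

variable {H : Type*} [NormedAddCommGroup H] [InnerProductSpace ℂ H]
  {K : Submodule ℂ H} [K.HasOrthogonalProjection]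

theorem inner_compression (A : H →L[ℂ] H) (k x : K) :
    ⟪k, compression K A x⟫_ℂ = ⟪(k : H), A x⟫_ℂ := by
  simp [compression]

/-- Paired with `k ∈ K`, the factor `A` moves to `A* k`, which is still in `K`, so the projection
after `B` changes nothing. -/
theorem compression_mul_apply [CompleteSpace H] {A : H →L[ℂ] H} (hA : ∀ k ∈ K, adjoint A k ∈ K) (B : H →L[ℂ] H)
    (x : K) : compression K (A * B) x = compression K A (compression K B x) := by
  refine ext_inner_left ℂ fun k => ?_
  have h := inner_compression B ⟨adjoint A k, hA k k.2⟩ x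
  rw [Submodule.coe_inner] at h
  rw [inner_compression, inner_compression, mul_apply_eq_comp, ← adjoint_inner_left A,
    ← adjoint_inner_left A]
  exact h.symm

end Compression

/-! ### The constrained co-extension: spectrum, support and common zeros -/

section Coextension

variable {d : ℕ} {Ψ : ℂ → Cd d →L[ℂ] Cd d} {H : Type*} [NormedAddCommGroup H]
  [InnerProductSpace ℂ H] [CompleteSpace H] {J : H →ₗᵢ[ℂ] Hardy (Cd d)} {f g : ℂ × ℂ → ℂ}

theorem mem_coextSpace {k : Hardy (Cd d)} :
    k ∈ coextSpace J Ψ ↔ ∀ f ∈ ann J Ψ, adjoint (modelCalc Ψ f) k = 0 := by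
  simp [coextSpace, Submodule.mem_iInf]

theorem modelAnn_subset_ann : modelAnn Ψ ⊆ ann J Ψ := fun f hf =>
  ⟨hf.1, by rw [pairCalc, hf.2]; simp⟩

theorem const_mul_mem_ann (hΨ : IsRationalPureInner Ψ) (hf : f ∈ ann J Ψ) (c : ℂ) :
    (fun p => c * f p) ∈ ann J Ψ := by
  refine ⟨HInf.mul (HInf.const c) hf.1, ?_⟩
  have h := hf.2
  rw [pairCalc] at h ⊢
  rw [modelCalc_mul hΨ (HInf.const c) hf.1, modelCalc_const hΨ]
  ext1 x
  have hx := congrArg (fun T => T x) h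
  simp only [comp_apply, zero_apply] at hx ⊢
  rw [mul_apply_eq_comp, smul_apply, map_smul]
  change c • adjoint J.toContinuousLinearMap (modelCalc Ψ f (J.toContinuousLinearMap x)) = 0
  rw [hx, smul_zero]

/-- The adjoints of the model calculus commute, so each preserves the kernels of the others. -/
theorem adjoint_mem_coextSpace (hΨ : IsRationalPureInner Ψ) (hg : g ∈ HInf) {k : Hardy (Cd d)}
    (hk : k ∈ coextSpace J Ψ) : adjoint (modelCalc Ψ g) k ∈ coextSpace J Ψ := by
  rw [mem_coextSpace] at hk ⊢
  intro f hf
  refine ext_inner_right ℂ fun x => ?_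
  rw [adjoint_inner_left, adjoint_inner_left, ← mul_apply_eq_comp, modelCalc_comm hΨ hg hf.1,
    mul_apply_eq_comp, ← adjoint_inner_left, hk f hf, inner_zero_left, inner_zero_left]

/-- The functional calculus of the constrained co-extension. -/
def coextCalc (J : H →ₗᵢ[ℂ] Hardy (Cd d)) (Ψ : ℂ → Cd d →L[ℂ] Cd d) (f : ℂ × ℂ → ℂ) :
    coextSpace J Ψ →L[ℂ] coextSpace J Ψ :=
  compression (coextSpace J Ψ) (modelCalc Ψ f)

theorem coextCalc_mul (hΨ : IsRationalPureInner Ψ) (hf : f ∈ HInf) (hg : g ∈ HInf)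
    (x : coextSpace J Ψ) :
    coextCalc J Ψ (fun p => f p * g p) x = coextCalc J Ψ f (coextCalc J Ψ g x) := by
  rw [coextCalc, modelCalc_mul hΨ hf hg,
    compression_mul_apply fun k hk => adjoint_mem_coextSpace hΨ hf hk]
  rfl

theorem coextCalc_comm (hΨ : IsRationalPureInner Ψ) (hf : f ∈ HInf) (hg : g ∈ HInf)
    (x : coextSpace J Ψ) :
    coextCalc J Ψ f (coextCalc J Ψ g x) = coextCalc J Ψ g (coextCalc J Ψ f x) := by
  rw [← coextCalc_mul hΨ hf hg, ← coextCalc_mul hΨ hg hf]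
  simp only [mul_comm]

theorem coextCalc_add (hΨ : IsRationalPureInner Ψ) (hf : f ∈ HInf) (hg : g ∈ HInf) :
    coextCalc J Ψ (fun p => f p + g p) = coextCalc J Ψ f + coextCalc J Ψ g := by
  ext1 x
  simp [coextCalc, compression, modelCalc_add hΨ hf hg]

theorem coextCalc_const (hΨ : IsRationalPureInner Ψ) (c : ℂ) :
    coextCalc J Ψ (fun _ => c) = c • ContinuousLinearMap.id ℂ (coextSpace J Ψ) := by
  ext1 x
  simp [coextCalc, compression, modelCalc_const hΨ]

theorem coextCalc_eq_zero (hf : f ∈ ann J Ψ) : coextCalc J Ψ f = 0 := by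
  ext1 x
  refine ext_inner_left ℂ fun k => ?_
  rw [coextCalc, inner_compression, ← adjoint_inner_left, mem_coextSpace.1 k.2 f hf,
    inner_zero_left, zero_apply, inner_zero_right]

theorem coextCalc_fst_sub (hΨ : IsRationalPureInner Ψ) (c : ℂ) :
    coextCalc J Ψ (fun p => p.1 - c) =
      coextS₁ J Ψ - c • ContinuousLinearMap.id ℂ (coextSpace J Ψ) := by
  simp only [sub_eq_add_neg]
  rw [coextCalc_add hΨ HInf.fst (HInf.const (-c)), coextCalc_const hΨ, coextCalc,
    modelCalc_fst hΨ, coextS₁]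
  exact congrArg _ (neg_smul c (ContinuousLinearMap.id ℂ (coextSpace J Ψ)))

theorem coextCalc_snd_sub (hΨ : IsRationalPureInner Ψ) (c : ℂ) :
    coextCalc J Ψ (fun p => p.2 - c) =
      coextS₂ J Ψ - c • ContinuousLinearMap.id ℂ (coextSpace J Ψ) := by
  simp only [sub_eq_add_neg]
  rw [coextCalc_add hΨ HInf.snd (HInf.const (-c)), coextCalc_const hΨ, coextCalc,
    modelCalc_snd hΨ, coextS₂]
  exact congrArg _ (neg_smul c (ContinuousLinearMap.id ℂ (coextSpace J Ψ)))

theorem taylorSpectrum_subset_supp (hΨ : IsRationalPureInner Ψ) :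
    taylorSpectrum (coextS₁ J Ψ) (coextS₂ J Ψ) ⊆ supp (ann J Ψ) := by
  rintro a ha ⟨φ, hφ, f, hf, g, hg, e⟩
  have hz : (fun p : ℂ × ℂ => p.1 - a.1) ∈ HInf := HInf.sub HInf.fst (HInf.const _)
  have hw : (fun p : ℂ × ℂ => p.2 - a.2) ∈ HInf := HInf.sub HInf.snd (HInf.const _)
  refine notMem_taylorSpectrum (F := coextCalc J Ψ f) (G := coextCalc J Ψ g)
    ?_ ?_ ?_ ?_ ?_ ?_ ha
  all_goals
    simp only [← coextCalc_fst_sub hΨ, ← coextCalc_snd_sub hΨ]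
    intro x
  · exact coextCalc_comm hΨ hz hf x
  · exact coextCalc_comm hΨ hz hg x
  · exact coextCalc_comm hΨ hw hf x
  · exact coextCalc_comm hΨ hw hg x
  · exact coextCalc_comm hΨ hz hw x
  · have hsum := HInf.add (HInf.mul hz hf) (HInf.mul hw hg)
    -- The calculus is applied to the identity for `1`; the term `φ` disappears because it lies in
    -- the annihilator.
    have h1 : coextCalc J Ψ (fun _ => 1) = coextCalc J Ψ (fun p => φ p +
        ((p.1 - a.1) * f p + (p.2 - a.2) * g p)) :=
      congrArg (compression _) (modelCalc_congr hΨ (HInf.const 1) (HInf.add hφ.1 hsum)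
        fun p hp => by rw [← add_assoc]; exact e p hp)
    rw [coextCalc_const hΨ, coextCalc_add hΨ hφ.1 hsum, coextCalc_eq_zero hφ, zero_add,
      coextCalc_add hΨ (HInf.mul hz hf) (HInf.mul hw hg)] at h1
    have h2 := congrArg (fun T => T x) h1
    simp only [add_apply, coextCalc_mul hΨ hz hf, coextCalc_mul hΨ hw hg] at h2
    rw [← h2]
    exact one_smul ℂ x

/-- If `φ a ≠ 0`, Gleason division of `φ - φ a` at `a`, rescaled by `(φ a)⁻¹`, exhibits `1` in the
ideal. -/
theorem supp_inter_bidisc_subset_zeroSet (hΨ : IsRationalPureInner Ψ) :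
    supp (ann J Ψ) ∩ bidisc ⊆ zeroSet (ann J Ψ) := by
  rintro a ⟨ha, hab⟩
  refine ⟨hab, fun φ hφ => ?_⟩
  by_contra h0
  obtain ⟨f, hf, g, hg, e⟩ := HInf.exists_sub_eq hφ.1 hab
  refine ha ⟨_, const_mul_mem_ann hΨ hφ (φ a)⁻¹, _, HInf.mul (HInf.const (-(φ a)⁻¹)) hf,
    _, HInf.mul (HInf.const (-(φ a)⁻¹)) hg, fun p hp => ?_⟩
  have h1 := e p hp
  field_simp
  linear_combination -h1

/-- The vector `k_z ⊗ v`, with `v` a left eigenvector, is a joint eigenvector of the adjoints. It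
lies in `K_Ψ` as the annihilator vanishes at `a`, and it is orthogonal to the ranges of `S₁ - λ` and
`S₂ - μ`, so exactness fails at the last stage. -/
theorem zeroSet_subset_taylorSpectrum (hΨ : IsRationalPureInner Ψ) :
    zeroSet (ann J Ψ) ⊆ taylorSpectrum (coextS₁ J Ψ) (coextS₂ J Ψ) := by
  rintro a ⟨ha, hzero⟩
  have hV : a ∈ variety Ψ :=
    mem_variety_iff.2 ⟨ha, hzero _ (modelAnn_subset_ann (charFun_mem_modelAnn hΨ))⟩
  obtain ⟨v, hv0, hv⟩ := exists_left_eigenvector hV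
  have hcalc : ∀ f ∈ HInf, ∀ x, ⟪Hardy.kernel a.1 ha.1 v, modelCalc Ψ f x⟫_ℂ =
      f a * ⟪Hardy.kernel a.1 ha.1 v, x⟫_ℂ := fun f hf x => by
    rw [Hardy.inner_kernel, Hardy.inner_kernel, isMultOp_modelCalc hΨ hf x _ ha.1,
      inner_compΔ hΨ hf ha.1 ha.2 hv]
  have hk : Hardy.kernel a.1 ha.1 v ∈ coextSpace J Ψ := by
    refine mem_coextSpace.2 fun f hf => ext_inner_right ℂ fun x => ?_
    rw [adjoint_inner_left, hcalc f hf.1, hzero f hf, zero_mul, inner_zero_left]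
  set k : coextSpace J Ψ := ⟨_, hk⟩ with hkdef
  have hcalc' : ∀ f ∈ HInf, f a = 0 → ∀ x : coextSpace J Ψ, ⟪k, coextCalc J Ψ f x⟫_ℂ = 0 :=
    fun f hf h0 x => by rw [coextCalc, inner_compression, hcalc f hf, h0, zero_mul]
  rintro ⟨-, -, hsurj⟩
  obtain ⟨⟨x, y⟩, hxy⟩ := hsurj k
  simp only [koszul₁] at hxy
  rw [← coextCalc_fst_sub hΨ, ← coextCalc_snd_sub hΨ] at hxy
  have h1 : ⟪k, k⟫_ℂ = 0 := by
    nth_rw 2 [← hxy]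
    rw [inner_sub_right, hcalc' _ (HInf.sub HInf.fst (HInf.const _)) (sub_self _),
      hcalc' _ (HInf.sub HInf.snd (HInf.const _)) (sub_self _), sub_zero]
  have hk0 : k = 0 := inner_self_eq_zero.1 h1
  have h2 : Hardy.kernel a.1 ha.1 v = 0 := congrArg (fun x : coextSpace J Ψ => (x : Hardy (Cd d))) hk0
  have h3 := Hardy.norm_sq_kernel ha.1 v
  rw [h2, norm_zero, zero_pow two_ne_zero, eq_comm, mul_eq_zero, inv_eq_zero, sq_eq_zero_iff,
    norm_eq_zero] at h3
  have h4 := pow_lt_one₀ (norm_nonneg a.1) (mem_disc_iff.1 ha.1) two_ne_zero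
  rcases h3 with h3 | h3
  · linarith
  · exact hv0 h3

end Coextension

end Bidisc

end

theorem theorem3p13 {H : Type*} [NormedAddCommGroup H] [InnerProductSpace ℂ H] [CompleteSpace H]
    (T₁ T₂ : H →L[ℂ] H) (hcomm : T₁ ∘L T₂ = T₂ ∘L T₁)
    (hT₁ : Bidisc.IsPureContraction T₁) (hT₂ : Bidisc.IsPureContraction T₂)
    (hd₁ : FiniteDimensional ℂ (Bidisc.defectSpace T₁))
    (hd₂ : FiniteDimensional ℂ (Bidisc.defectSpace T₂))
    (d : ℕ) (hd : d = Module.finrank ℂ (Bidisc.defectSpace T₁))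
    (Ψ : ℂ → Bidisc.Cd d →L[ℂ] Bidisc.Cd d) (hΨ : Bidisc.IsRationalPureInner Ψ)
    (J : H →ₗᵢ[ℂ] Bidisc.Hardy (Bidisc.Cd d)) (hJ : Bidisc.IsCoextension T₁ T₂ J Ψ) :
    (Bidisc.taylorSpectrum (Bidisc.coextS₁ J Ψ) (Bidisc.coextS₂ J Ψ) ⊆
        Bidisc.supp (Bidisc.ann J Ψ) ∧
      Bidisc.supp (Bidisc.ann J Ψ) ⊆ closure (Bidisc.variety Ψ) ∧
      closure (Bidisc.variety Ψ) = Bidisc.supp (Bidisc.modelAnn Ψ)) ∧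
    (Bidisc.taylorSpectrum (Bidisc.coextS₁ J Ψ) (Bidisc.coextS₂ J Ψ) ∩ Bidisc.bidisc =
        Bidisc.supp (Bidisc.ann J Ψ) ∩ Bidisc.bidisc ∧
      Bidisc.supp (Bidisc.ann J Ψ) ∩ Bidisc.bidisc = Bidisc.zeroSet (Bidisc.ann J Ψ)) := by
  -- The support reverses inclusions of ideals.
  have hmono : Bidisc.supp (Bidisc.ann J Ψ) ⊆ Bidisc.supp (Bidisc.modelAnn Ψ) :=
    fun a ha ⟨φ, hφ, h⟩ => ha ⟨φ, Bidisc.modelAnn_subset_ann hφ, h⟩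
  have h1 := Bidisc.taylorSpectrum_subset_supp (J := J) hΨ
  have h2 := Bidisc.supp_inter_bidisc_subset_zeroSet (J := J) hΨ
  have h3 := Bidisc.zeroSet_subset_taylorSpectrum (J := J) hΨ
  have h4 : Bidisc.zeroSet (Bidisc.ann J Ψ) ⊆ Bidisc.bidisc := fun _ ha => ha.1
  refine ⟨⟨h1, hmono.trans (Bidisc.supp_modelAnn_subset hΨ),
    (Bidisc.closure_variety_subset hΨ).antisymm (Bidisc.supp_modelAnn_subset hΨ)⟩, ?_, ?_⟩
  · exact (Set.inter_subset_inter_left _ h1).antisymm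
      (Set.subset_inter (h2.trans h3) Set.inter_subset_right)
  · exact h2.antisymm (Set.subset_inter (h3.trans h1) h4)
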